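/- Let $H$ be a complex Hilbert space and let $X,Y\subset B(H)$ be linear subspaces (operator spaces); norms of rectangular matrices over $B(H)$ are operator norms between the Hilbert space direct sums $H^n$, and norms of scalar matrices are operator norms between Euclidean spaces. For $x\in M_{n,r}(X)$, $y\in M_{r,n}(Y)$ put $x\odot y=[\sum_k x_{ik}\otimes y_{kj}]\in M_n(X\otimes Y)$ (algebraic tensor product), and for $u\in M_n(X\otimes Y)$ define $$\|u\|_h=\inf\{\|x\|\,\|y\| : u=x\odot y\},\qquad \|u\|_{wh}=\inf\{\tfrac12\|xx^*+y^*y\| : u=x\odot y\},$$ the infima being over all $r\in\mathbb N$, $x\in M_{n,r}(X)$, $y\in M_{r,n}(Y)$ with $u=x\odot y$. Let $X^\dagger=\{x^*: x\in X\}$, and for $u\in M_n(X\otimes X^\dagger)$ define $$\|u\|_{wcb}=\inf\{\tfrac12\|a\|\,\|x\|^2 : u=xa\odot x^*,\ x\in M_{n,r}(X),\ a\in M_r(\mathbb C),\ r\in\mathbb N\}.$$ An operator space structure on a complex vector space $V$ is a sequence of norms $\mathcal O_n$ on $M_n(V)$ with $\mathcal O_{m+n}(\mathrm{diag}(x,y))=\max\{\mathcal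 O_m(x),\mathcal O_n(y)\}$ and $\mathcal O_n(\alpha x\beta)\le\|\alpha\|\mathcal O_m(x)\|\beta\|$ for $x\in M_m(V)$, $y\in M_n(V)$, $\alpha\in M_{n,m}(\mathbb C)$, $\beta\in M_{m,n}(\mathbb C)$. A sequence of norms $\mathcal W_n$ on $M_n(V)$ is a numerical radius norm affiliated with the operator space $(V,\mathcal O_n)$ if $\mathcal W_{m+n}(\mathrm{diag}(x,y))=\max\{\mathcal W_m(x),\mathcal W_n(y)\}$, $\mathcal W_n(\alpha x\alpha^*)\le\|\alpha\|^2\mathcal W_m(x)$, and $\tfrac12\mathcal O_n(x)=\mathcal W_{2n}\begin{pmatrix}0&x\\0&0\end{pmatrix}$ for all $x\in M_n(V)$. Then every $u\in M_n(X\otimes Y)$ has the form $x\odot y$, and: (a) $\|\cdot\|_h$ is an operator space structure on $X\otimes Y$, and $\|\cdot\|_{wh}$ is a numerical radius norm affiliated with $(X\otimes Y,\|\cdot\|_h)$. (b) On $X\otimes X^\dagger$, both $\|\cdot\|_{wh}$ and $\|\cdot\|_{wcb}$ are numerical radius norms affiliated with $(X\otimes X^\dagger,\|\cdot\|_h)$.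 Moreover, for all $n$ and $u\in M_n(X\otimes X^\dagger)$, $$\|u\|_{wh}=\inf\{w(a)\,\|x\|^2 : u=xa\odot x^*,\ x\in M_{n,r}(X),\ a\in M_r(\mathbb C),\ r\in\mathbb N\},$$ where $w(a)=\sup\{|\langle a\xi,\xi\rangle| : \|\xi\|=1\}$ is the numerical radius, and $$\tfrac12\|u\|_h\le\|u\|_{wcb}\le\|u\|_{wh}\le\|u\|_h .$$ -/

import Mathlib

open scoped TensorProduct Matrix

namespace NumRadiusOp

noncomputable section

/-! ### Matrices over a complex vector space -/

section Abstract

variable {V : Type*} [AddCommGroup V] [Module ℂ V]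

/-- The two-sided product `α x β` of a matrix `x` over `V` with scalar matrices `α`, `β`. -/
def sandwich {k l m n : ℕ} (α : Matrix (Fin k) (Fin l) ℂ) (x : Matrix (Fin l) (Fin m) V)
    (β : Matrix (Fin m) (Fin n) ℂ) : Matrix (Fin k) (Fin n) V :=
  Matrix.of fun i j => ∑ p, ∑ q, (α i p * β q j) • x p q

/-- The block matrix `[[x, 0], [0, y]]` of size `m + n`. -/
def diagBlock {m n : ℕ} (x : Matrix (Fin m) (Fin m) V) (y : Matrix (Fin n) (Fin n) V) :
    Matrix (Fin (m + n)) (Fin (m + n)) V :=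
  Matrix.reindex finSumFinEquiv finSumFinEquiv (Matrix.fromBlocks x 0 0 y)

/-- The block matrix `[[0, x], [0, 0]]` of size `n + n`. -/
def cornerBlock {n : ℕ} (x : Matrix (Fin n) (Fin n) V) :
    Matrix (Fin (n + n)) (Fin (n + n)) V :=
  Matrix.reindex finSumFinEquiv finSumFinEquiv (Matrix.fromBlocks 0 x 0 0)

open scoped Matrix.Norms.L2Operator in
/-- The operator norm of a scalar matrix, acting between Euclidean spaces. -/
def scalarNorm {m n : ℕ} (α : Matrix (Fin m) (Fin n) ℂ) : ℝ := ‖α‖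

/-- The numerical radius `sup {|⟨a ξ, ξ⟩| : ‖ξ‖ = 1}` of a scalar matrix. -/
def numericalRadius {n : ℕ} (a : Matrix (Fin n) (Fin n) ℂ) : ℝ :=
  ⨆ ξ : {ξ : EuclideanSpace ℂ (Fin n) // ‖ξ‖ = 1},
    ‖inner ℂ (Matrix.toEuclideanCLM (n := Fin n) (𝕜 := ℂ) a ξ.1) ξ.1‖

variable (V) in
/-- A function on each of the spaces of `n × n` matrices over `V`. -/
abbrev MatrixFun : Type _ := ∀ n : ℕ, Matrix (Fin n) (Fin n) V → ℝ

/-- `N n` is a norm on the `n × n` matrices over `V`, for each `n`. -/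
structure IsMatrixNorm (N : MatrixFun V) : Prop where
  nonneg : ∀ (n : ℕ) (x : Matrix (Fin n) (Fin n) V), 0 ≤ N n x
  add_le : ∀ (n : ℕ) (x y : Matrix (Fin n) (Fin n) V), N n (x + y) ≤ N n x + N n y
  smul : ∀ (n : ℕ) (c : ℂ) (x : Matrix (Fin n) (Fin n) V), N n (c • x) = ‖c‖ * N n x
  eq_zero : ∀ (n : ℕ) (x : Matrix (Fin n) (Fin n) V), N n x = 0 → x = 0

/-- Ruan's axioms: `V` with the norms `O n` is an (abstract) operator space. -/
structure IsOperatorSpace (O : MatrixFun V) : Prop extends IsMatrixNorm O where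
  diag : ∀ (m n : ℕ) (x : Matrix (Fin m) (Fin m) V) (y : Matrix (Fin n) (Fin n) V),
    O (m + n) (diagBlock x y) = max (O m x) (O n y)
  sandwich_le : ∀ (m n : ℕ) (α : Matrix (Fin n) (Fin m) ℂ) (x : Matrix (Fin m) (Fin m) V)
    (β : Matrix (Fin m) (Fin n) ℂ),
    O n (sandwich α x β) ≤ scalarNorm α * O m x * scalarNorm β

/-- `V` with the norms `W n` is a numerical radius operator space: norms with
`W [[x, 0], [0, y]] = max (W x) (W y)` and `W (α x α*) ≤ ‖α‖² W x`. -/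
structure IsNumericalRadiusSpace (W : MatrixFun V) : Prop extends IsMatrixNorm W where
  diag : ∀ (m n : ℕ) (x : Matrix (Fin m) (Fin m) V) (y : Matrix (Fin n) (Fin n) V),
    W (m + n) (diagBlock x y) = max (W m x) (W n y)
  sandwich_le : ∀ (m n : ℕ) (α : Matrix (Fin n) (Fin m) ℂ) (x : Matrix (Fin m) (Fin m) V),
    W n (sandwich α x αᴴ) ≤ scalarNorm α ^ 2 * W m x

/-- `W` is a numerical radius norm affiliated with the operator space `(V, O)`. -/
structure IsAffiliated (W O : MatrixFun V) : Prop where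
  operatorSpace : IsOperatorSpace O
  numericalRadiusSpace : IsNumericalRadiusSpace W
  ow : ∀ (n : ℕ) (x : Matrix (Fin n) (Fin n) V), 1 / 2 * O n x = W (n + n) (cornerBlock x)

end Abstract

/-! ### Matrices of operators on a Hilbert space -/

section Concrete

variable {H : Type*} [NormedAddCommGroup H] [InnerProductSpace ℂ H]

/-- The operator `H^n → H^m` (Hilbert space direct sums) given by an `m × n` matrix of bounded
operators on `H`. -/
def matrixOp {m n : ℕ} (x : Matrix (Fin m) (Fin n) (H →L[ℂ] H)) :
    PiLp 2 (fun _ : Fin n => H) →L[ℂ] PiLp 2 (fun _ : Fin m => H) :=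
  (PiLp.continuousLinearEquiv 2 ℂ (fun _ : Fin m => H)).symm.toContinuousLinearMap ∘L
    ContinuousLinearMap.pi fun i => ∑ j, x i j ∘L PiLp.proj 2 (fun _ : Fin n => H) j

/-- The operator norm of a matrix of bounded operators on `H`. -/
def opNorm {m n : ℕ} (x : Matrix (Fin m) (Fin n) (H →L[ℂ] H)) : ℝ := ‖matrixOp x‖

/-- A matrix over a subspace of `B(H)`, as a matrix of operators. -/
def toOp {X : Submodule ℂ (H →L[ℂ] H)} {m n : ℕ} (x : Matrix (Fin m) (Fin n) X) :
    Matrix (Fin m) (Fin n) (H →L[ℂ] H) :=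
  x.map Subtype.val

/-- `x ⊙ y = [∑ₖ x i k ⊗ y k j]`. -/
def odot {X Y : Submodule ℂ (H →L[ℂ] H)} {n r : ℕ} (x : Matrix (Fin n) (Fin r) X)
    (y : Matrix (Fin r) (Fin n) Y) : Matrix (Fin n) (Fin n) (X ⊗[ℂ] Y) :=
  Matrix.of fun i j => ∑ k, x i k ⊗ₜ[ℂ] y k j

/-- The product `x a` of a matrix over `X` with a scalar matrix. -/
def rightMul {X : Submodule ℂ (H →L[ℂ] H)} {n r s : ℕ} (x : Matrix (Fin n) (Fin r) X)
    (a : Matrix (Fin r) (Fin s) ℂ) : Matrix (Fin n) (Fin s) X :=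
  Matrix.of fun i j => ∑ k, a k j • x i k

/-- The Haagerup norm on the matrices over `X ⊗ Y`. -/
def hNorm (X Y : Submodule ℂ (H →L[ℂ] H)) : MatrixFun (X ⊗[ℂ] Y) := fun n u =>
  sInf {t : ℝ | ∃ (r : ℕ) (x : Matrix (Fin n) (Fin r) X) (y : Matrix (Fin r) (Fin n) Y),
    u = odot x y ∧ t = opNorm (toOp x) * opNorm (toOp y)}

variable [CompleteSpace H]

/-- `‖u‖_wh = inf {½ ‖x x* + y* y‖ : u = x ⊙ y}`. -/
def whNorm (X Y : Submodule ℂ (H →L[ℂ] H)) : MatrixFun (X ⊗[ℂ] Y) := fun n u =>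
  sInf {t : ℝ | ∃ (r : ℕ) (x : Matrix (Fin n) (Fin r) X) (y : Matrix (Fin r) (Fin n) Y),
    u = odot x y ∧ t = 1 / 2 * opNorm (toOp x * (toOp x)ᴴ + (toOp y)ᴴ * toOp y)}

/-- The space `X† = {x* : x ∈ X}` of adjoints. -/
def dagger (X : Submodule ℂ (H →L[ℂ] H)) : Submodule ℂ (H →L[ℂ] H) where
  carrier := {T | ∃ x ∈ X, T = star x}
  add_mem' := by
    rintro _ _ ⟨x, hx, rfl⟩ ⟨y, hy, rfl⟩
    exact ⟨x + y, X.add_mem hx hy, (star_add x y).symm⟩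
  zero_mem' := ⟨0, X.zero_mem, (star_zero _).symm⟩
  smul_mem' := by
    rintro c _ ⟨x, hx, rfl⟩
    exact ⟨star c • x, X.smul_mem _ hx, by rw [star_smul, star_star]⟩

/-- The adjoint `x* = [x j i *]` of a matrix over `X`, as a matrix over `X†`. -/
def adj {X : Submodule ℂ (H →L[ℂ] H)} {n r : ℕ} (x : Matrix (Fin n) (Fin r) X) :
    Matrix (Fin r) (Fin n) (dagger X) :=
  Matrix.of fun i j => ⟨star (x j i : H →L[ℂ] H), x j i, (x j i).2, rfl⟩

/-- `‖u‖_wcb = inf {½ ‖a‖ ‖x‖² : u = x a ⊙ x*}` on the matrices over `X ⊗ X†`. -/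
def wcbNorm (X : Submodule ℂ (H →L[ℂ] H)) : MatrixFun (X ⊗[ℂ] dagger X) := fun n u =>
  sInf {t : ℝ | ∃ (r : ℕ) (x : Matrix (Fin n) (Fin r) X) (a : Matrix (Fin r) (Fin r) ℂ),
    u = odot (rightMul x a) (adj x) ∧ t = 1 / 2 * scalarNorm a * opNorm (toOp x) ^ 2}

end Concrete

end

end NumRadiusOp

open NumRadiusOp

/-! All three norms are gauges: having norm below `c` means admitting a factorization with bound `c`
(`HaagerupFac`, `WhFac`, `WcbFac`). Factorizations add by concatenating inner indices, go on a
diagonal as block sums, and compress by acting on the outer indices;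
`isNumericalRadiusSpace_of_factorization` turns this into the axioms. Definiteness is separate:
vector functionals separate the points of `X ⊗ Y` and are controlled by the Haagerup norm, which is
at most twice each of the other two norms. Affiliation holds because in a corner block the two
factors act on orthogonal summands, so their bounds combine as a maximum instead of a sum, which
gains the factor 1/2.

On `X ⊗ X†` the link between the norms is `x ⊙ y* = z a ⊙ z*` with `z = [x y]` and `a = [[0, 1], [0,
0]]`: here `‖a‖ ≤ 1`, the numerical radius of `a` is at most 1/2, and `z z* = x x* + y y*`. This
gives `‖u‖_wcb ≤ ‖u‖_wh` and one half of the numerical radius formula.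

The other half is Ando's theorem in approximate form (`NumRadLE.exists_factor`): if `w(a) < s < t`,
then `a = b c` with `b b* + c* c ≤ 2t`, whence `x a ⊙ x* = x b ⊙ c x*` has the required bound. To
find `b` and `c`, note that the tridiagonal block Toeplitz matrices with diagonal `2s` and
neighbours `a`, `a*` are positive definite, so their Schur complements `A₀ = 2s`, `Aₖ₊₁ = 2s - a*
Aₖ⁻¹ a` are too. Each `Aₖ` gives `a = bₖ cₖ` with `bₖ bₖ* + cₖ* cₖ = 2s + Aₖ - Aₖ₊₁`; averaging over
`k` telescopes the error away.

Bounds are kept as quadratic inequalities over arbitrary finite index types (`OpBdd`, `ScalarBdd`,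
`NumRadLE`), so that sums and sigma types can serve as inner indices; `Fin r` and the norms return
only at the end. -/

namespace NumRadiusOp

noncomputable section

open scoped ComplexOrder

/-! ### Matrices with numerical radius at most `w` -/

section Numerical

variable {ι : Type*} [Fintype ι]

/-- `|⟨a ξ, ξ⟩| ≤ w ‖ξ‖²` for all vectors `ξ`. -/
def NumRadLE (a : Matrix ι ι ℂ) (w : ℝ) : Prop :=
  ∀ ξ : ι → ℂ, ‖star ξ ⬝ᵥ (a *ᵥ ξ)‖ ≤ w * ∑ i, ‖ξ i‖ ^ 2

theorem star_dotProduct_self (ξ : ι → ℂ) : star ξ ⬝ᵥ ξ = ((∑ i, ‖ξ i‖ ^ 2 : ℝ) : ℂ) := by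
  simp [dotProduct, Complex.conj_mul']

/-- Orthogonality of the characters of a cyclic group; the bounds on `p` and `q` make distinct
exponents distinct modulo `N`. -/
theorem sum_pow_mul_star_pow {N : ℕ} {ζ : ℂ} (hζ : IsPrimitiveRoot ζ N) {p q : ℕ} (hp : p < N)
    (hq : q < N) :
    ∑ m ∈ Finset.range N, (ζ ^ m) ^ p * star ((ζ ^ m) ^ q) = if p = q then (N : ℂ) else 0 := by
  have hN : N ≠ 0 := by omega
  have hs : ζ * star ζ = 1 := by
    have h1 : ‖ζ‖ = 1 := hζ.norm'_eq_one hN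
    simp [Complex.mul_conj', h1]
  have key : ∀ m, (ζ ^ m) ^ p * star ((ζ ^ m) ^ q) = (ζ ^ p * star ζ ^ q) ^ m := by
    intro m
    simp only [star_pow]
    ring
  simp only [key]
  split_ifs with h
  · subst h
    rw [← mul_pow, hs]
    simp
  · have h1 : ζ ^ p * star ζ ^ q ≠ 1 := by
      intro h2
      apply h
      apply hζ.pow_inj hp hq
      calc ζ ^ p = ζ ^ p * (ζ * star ζ) ^ q := by rw [hs, one_pow, mul_one]
        _ = (ζ ^ p * star ζ ^ q) * ζ ^ q := by ring
        _ = ζ ^ q := by rw [h2, one_mul]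
    have h3 : (ζ ^ p * star ζ ^ q) ^ N = 1 := by
      have e : (ζ ^ p * star ζ ^ q) ^ N = (ζ ^ N) ^ p * star (ζ ^ N) ^ q := by
        simp only [star_pow]; ring
      rw [e, hζ.pow_eq_one]; simp
    rw [geom_sum_eq h1, h3]; simp

theorem star_sum_smul_dotProduct (a : Matrix ι ι ℂ) (n : ℕ) (z : ℂ) (f : ℕ → ι → ℂ) :
    star (∑ k ∈ Finset.range n, z ^ k • f k) ⬝ᵥ (a *ᵥ ∑ k ∈ Finset.range n, z ^ k • f k) =
      ∑ k ∈ Finset.range n, ∑ j ∈ Finset.range n,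
        z ^ j * star (z ^ k) * (star (f k) ⬝ᵥ (a *ᵥ f j)) := by
  simp only [star_sum, star_smul, sum_dotProduct, Matrix.mulVec_sum, dotProduct_sum,
    Matrix.mulVec_smul, smul_dotProduct, dotProduct_smul, smul_eq_mul, Finset.mul_sum]
  rw [Finset.sum_comm]
  refine Finset.sum_congr rfl fun k _ => Finset.sum_congr rfl fun j _ => ?_
  ring

/-- Averaging the form of `a` over the roots of unity extracts its `d`-th off-diagonal. -/
theorem sum_roots_form (a : Matrix ι ι ℂ) {N n d : ℕ} {ζ : ℂ} (hζ : IsPrimitiveRoot ζ N)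
    (hn : n + d ≤ N) (f : ℕ → ι → ℂ) :
    ∑ m ∈ Finset.range N, (ζ ^ m) ^ d * (star (∑ k ∈ Finset.range n, (ζ ^ m) ^ k • f k) ⬝ᵥ
      (a *ᵥ ∑ k ∈ Finset.range n, (ζ ^ m) ^ k • f k)) =
    N * ∑ k ∈ Finset.range n, ∑ j ∈ Finset.range n,
      if j + d = k then star (f k) ⬝ᵥ (a *ᵥ f j) else 0 := by
  simp only [star_sum_smul_dotProduct, Finset.mul_sum]
  rw [Finset.sum_comm]
  refine Finset.sum_congr rfl fun k hk => ?_
  rw [Finset.sum_comm]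
  refine Finset.sum_congr rfl fun j hj => ?_
  rw [Finset.mem_range] at hk hj
  have := sum_pow_mul_star_pow hζ (p := j + d) (q := k) (by omega) (by omega)
  calc _ = (∑ m ∈ Finset.range N, (ζ ^ m) ^ (j + d) * star ((ζ ^ m) ^ k)) *
        (star (f k) ⬝ᵥ (a *ᵥ f j)) := by
        rw [Finset.sum_mul]
        refine Finset.sum_congr rfl fun m _ => ?_
        ring
    _ = _ := by rw [this]; split_ifs <;> simp

/-- Apply the bound on the form of `a` to the trigonometric polynomial `P = ∑ zᵏ fₖ` at roots of
unity and average. The first Fourier coefficient of `⟨a P, P⟩` is the shifted sum on the left, and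
Parseval evaluates the average of `‖P‖²`. -/
theorem NumRadLE.norm_sum_shift_le {a : Matrix ι ι ℂ} {w : ℝ} (ha : NumRadLE a w) (n : ℕ)
    (f : ℕ → ι → ℂ) :
    ‖∑ k ∈ Finset.range n, star (f (k + 1)) ⬝ᵥ (a *ᵥ f k)‖ ≤
      w * ∑ k ∈ Finset.range (n + 1), ∑ i, ‖f k i‖ ^ 2 := by
  classical
  -- Exponents `j + 1` and `k` with `j, k ≤ n` occur, so order `n + 2` is enough to avoid aliasing.
  obtain ⟨ζ, hζ⟩ : ∃ ζ : ℂ, IsPrimitiveRoot ζ (n + 2) :=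
    ⟨_, Complex.isPrimitiveRoot_exp (n + 2) (by omega)⟩
  set P : ℕ → ι → ℂ := fun m => ∑ k ∈ Finset.range (n + 1), (ζ ^ m) ^ k • f k with hP
  have h1 := sum_roots_form a (N := n + 2) (n := n + 1) (d := 1) hζ le_rfl f
  have h0 := sum_roots_form (1 : Matrix ι ι ℂ) (N := n + 2) (n := n + 1) (d := 0) hζ (by omega) f
  have e1 : ∑ k ∈ Finset.range (n + 1), ∑ j ∈ Finset.range (n + 1),
      (if j + 1 = k then star (f k) ⬝ᵥ (a *ᵥ f j) else 0) =
      ∑ k ∈ Finset.range n, star (f (k + 1)) ⬝ᵥ (a *ᵥ f k) := by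
    rw [Finset.sum_range_succ']
    simp only [Nat.add_right_cancel_iff, Nat.add_eq_zero_iff, one_ne_zero, and_false, if_false,
      Finset.sum_const_zero, add_zero]
    refine Finset.sum_congr rfl fun k hk => ?_
    rw [Finset.mem_range] at hk
    rw [Finset.sum_ite_eq' , if_pos (Finset.mem_range.2 (by omega))]
  have e0 : ∑ k ∈ Finset.range (n + 1), ∑ j ∈ Finset.range (n + 1),
      (if j + 0 = k then star (f k) ⬝ᵥ ((1 : Matrix ι ι ℂ) *ᵥ f j) else 0) =
      ((∑ k ∈ Finset.range (n + 1), ∑ i, ‖f k i‖ ^ 2 : ℝ) : ℂ) := by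
    rw [Complex.ofReal_sum]
    refine Finset.sum_congr rfl fun k hk => ?_
    simp only [add_zero, Matrix.one_mulVec]
    rw [Finset.sum_ite_eq', if_pos hk, star_dotProduct_self]
  rw [e1] at h1
  rw [e0] at h0
  have h0' : ∑ m ∈ Finset.range (n + 2), ∑ i, ‖P m i‖ ^ 2 =
      (n + 2 : ℝ) * ∑ k ∈ Finset.range (n + 1), ∑ i, ‖f k i‖ ^ 2 := by
    have : ((∑ m ∈ Finset.range (n + 2), ∑ i, ‖P m i‖ ^ 2 : ℝ) : ℂ) =
        ((n + 2 : ℝ) * ∑ k ∈ Finset.range (n + 1), ∑ i, ‖f k i‖ ^ 2 : ℝ) := by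
      rw [Complex.ofReal_mul, Complex.ofReal_sum]
      simp only [pow_zero, one_mul, Matrix.one_mulVec] at h0
      push_cast at h0 ⊢
      rw [← h0]
      refine Finset.sum_congr rfl fun m _ => ?_
      have := star_dotProduct_self (P m)
      push_cast at this
      exact this.symm
    exact_mod_cast this
  have h2 : ((n : ℝ) + 2) * ‖∑ k ∈ Finset.range n, star (f (k + 1)) ⬝ᵥ (a *ᵥ f k)‖ ≤
      ((n : ℝ) + 2) * (w * ∑ k ∈ Finset.range (n + 1), ∑ i, ‖f k i‖ ^ 2) := by
    calc _ = ‖((n + 2 : ℕ) : ℂ) * ∑ k ∈ Finset.range n, star (f (k + 1)) ⬝ᵥ (a *ᵥ f k)‖ := by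
          rw [norm_mul, Complex.norm_natCast]; push_cast; rfl
      _ ≤ ∑ m ∈ Finset.range (n + 2), ‖(ζ ^ m) ^ 1 * (star (P m) ⬝ᵥ (a *ᵥ P m))‖ := by
          rw [← h1]; exact norm_sum_le _ _
      _ ≤ ∑ m ∈ Finset.range (n + 2), w * ∑ i, ‖P m i‖ ^ 2 := by
          refine Finset.sum_le_sum fun m _ => ?_
          have hζ1 : ‖ζ‖ = 1 := hζ.norm'_eq_one (by omega)
          simpa [hζ1] using ha (P m)
      _ = _ := by rw [← Finset.mul_sum, h0']; ring
  exact le_of_mul_le_mul_left h2 (by positivity)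

/-! ### Positivity of block Toeplitz matrices through Schur complements. -/

variable [DecidableEq ι]

/-- The Schur complements of the block Toeplitz matrices with `2 s` on the diagonal and `a` next
to it. -/
def schurSeq (a : Matrix ι ι ℂ) (s : ℝ) : ℕ → Matrix ι ι ℂ
  | 0 => ((2 * s : ℝ) : ℂ) • 1
  | n + 1 => ((2 * s : ℝ) : ℂ) • 1 - aᴴ * (schurSeq a s n)⁻¹ * a

/-- The form of a Schur complement at `v` is the value of the block Toeplitz form at a vector whose
first block is `v` and whose other blocks are chosen optimally. The recursion is completion of the
square. -/
theorem schurSeq_form (a : Matrix ι ι ℂ) (s : ℝ) (n : ℕ)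
    (h : ∀ k < n, (schurSeq a s k).PosDef) (v : ι → ℂ) :
    ∃ f : ℕ → ι → ℂ, f 0 = v ∧ star v ⬝ᵥ (schurSeq a s n *ᵥ v) =
      ((2 * s : ℝ) : ℂ) * ∑ k ∈ Finset.range (n + 1), star (f k) ⬝ᵥ f k +
        (∑ k ∈ Finset.range n, star (f (k + 1)) ⬝ᵥ (a *ᵥ f k) +
          star (∑ k ∈ Finset.range n, star (f (k + 1)) ⬝ᵥ (a *ᵥ f k))) := by
  induction n generalizing v with
  | zero =>
    refine ⟨fun _ => v, rfl, ?_⟩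
    simp [schurSeq, Matrix.smul_mulVec]
  | succ n ih =>
    set A := schurSeq a s n with hA
    have hpd : A.PosDef := h n (Nat.lt_succ_self n)
    have hdet : IsUnit A.det := hpd.isUnit.map Matrix.detMonoidHom
    have hherm : (A⁻¹)ᴴ = A⁻¹ := by rw [Matrix.conjTranspose_nonsing_inv, hpd.isHermitian.eq]
    -- `-A⁻¹ a v` minimizes `⟨A g, g⟩ + 2 Re ⟨a v, g⟩` over `g`, with minimum `-q`.
    obtain ⟨f, hf0, hf⟩ := ih (fun k hk => h k (by omega)) (-(A⁻¹ *ᵥ (a *ᵥ v)))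
    set q : ℂ := star (a *ᵥ v) ⬝ᵥ (A⁻¹ *ᵥ (a *ᵥ v)) with hq
    have hstar : star (A⁻¹ *ᵥ (a *ᵥ v)) ⬝ᵥ (a *ᵥ v) = q := by
      rw [Matrix.star_mulVec, hherm, ← Matrix.dotProduct_mulVec]
    have hQ : star (-(A⁻¹ *ᵥ (a *ᵥ v))) ⬝ᵥ (A *ᵥ -(A⁻¹ *ᵥ (a *ᵥ v))) = q := by
      rw [Matrix.mulVec_neg, star_neg, neg_dotProduct_neg, Matrix.mulVec_mulVec _ A,
        Matrix.mul_nonsing_inv _ hdet, Matrix.one_mulVec, hstar]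
    have hqs : star q = q := by
      conv_lhs => rw [hq, Matrix.star_dotProduct, star_star]
      exact hstar
    obtain ⟨g, hg0, hg1⟩ : ∃ g : ℕ → ι → ℂ, g 0 = v ∧ ∀ k, g (k + 1) = f k :=
      ⟨fun k => Nat.casesOn k v f, rfl, fun _ => rfl⟩
    refine ⟨g, hg0, ?_⟩
    rw [Finset.sum_range_succ' (fun k => star (g k) ⬝ᵥ g k) (n + 1),
      Finset.sum_range_succ' (fun k => star (g (k + 1)) ⬝ᵥ (a *ᵥ g k)) n]
    simp only [hg0, hg1, hf0]
    rw [hQ] at hf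
    have e : star v ⬝ᵥ (schurSeq a s (n + 1) *ᵥ v) = ((2 * s : ℝ) : ℂ) * (star v ⬝ᵥ v) - q := by
      rw [schurSeq, ← hA, Matrix.sub_mulVec, dotProduct_sub, Matrix.smul_mulVec,
        Matrix.one_mulVec, dotProduct_smul, smul_eq_mul, hq, Matrix.star_mulVec,
        Matrix.mul_assoc, ← Matrix.mulVec_mulVec, ← Matrix.mulVec_mulVec,
        Matrix.dotProduct_mulVec (star v)]
    rw [e, star_neg, neg_dotProduct, hstar, star_add, star_neg, hqs]
    linear_combination hf

theorem schurSeq_isHermitian {a : Matrix ι ι ℂ} {s : ℝ} (n : ℕ) :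
    (schurSeq a s n).IsHermitian := by
  have h1 : (((2 * s : ℝ) : ℂ) • (1 : Matrix ι ι ℂ)).IsHermitian := by
    rw [Matrix.IsHermitian, Matrix.conjTranspose_smul, Matrix.conjTranspose_one]
    simp
  induction n with
  | zero => exact h1
  | succ n ih => exact h1.sub (Matrix.isHermitian_conjTranspose_mul_mul a ih.inv)

theorem NumRadLE.schurSeq_posDef {a : Matrix ι ι ℂ} {w s : ℝ} (ha : NumRadLE a w) (hws : w < s)
    (n : ℕ) : (schurSeq a s n).PosDef := by
  induction n using Nat.strong_induction_on with
  | _ n ih =>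
    refine Matrix.PosDef.of_dotProduct_mulVec_pos (schurSeq_isHermitian n) fun v hv => ?_
    obtain ⟨f, hf0, hf⟩ := schurSeq_form a s n ih v
    have hb := ha.norm_sum_shift_le n f
    rw [hf]
    set z := ∑ k ∈ Finset.range n, star (f (k + 1)) ⬝ᵥ (a *ᵥ f k)
    set S := ∑ k ∈ Finset.range (n + 1), ∑ i, ‖f k i‖ ^ 2 with hS
    have e : ∑ k ∈ Finset.range (n + 1), star (f k) ⬝ᵥ f k = ((S : ℝ) : ℂ) := by
      simp only [star_dotProduct_self, hS, Complex.ofReal_sum]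
    have e2 : z + star z = ((2 * z.re : ℝ) : ℂ) := Complex.add_conj z
    have hSpos : 0 < S := by
      obtain ⟨i, hi⟩ : ∃ i, v i ≠ 0 := by
        by_contra! hc
        exact hv (funext hc)
      have h1 : 0 < ‖f 0 i‖ ^ 2 := by rw [hf0]; positivity
      calc 0 < ‖f 0 i‖ ^ 2 := h1
        _ ≤ ∑ i, ‖f 0 i‖ ^ 2 := Finset.single_le_sum (f := fun i => ‖f 0 i‖ ^ 2)
            (fun _ _ => by positivity) (Finset.mem_univ i)
        _ ≤ S := Finset.single_le_sum (f := fun k => ∑ i, ‖f k i‖ ^ 2)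
            (fun _ _ => by positivity) (Finset.mem_range.2 (by omega))
    have hre : -‖z‖ ≤ z.re := (abs_le.1 (Complex.abs_re_le_norm z)).1
    rw [e, e2, ← Complex.ofReal_mul, ← Complex.ofReal_add]
    -- The expression is at least `2 (s - w) S`, since `|Re z| ≤ w S`.
    have : 0 < 2 * s * S + 2 * z.re := by nlinarith
    exact_mod_cast this

end Numerical

/-! ### Ando's factorization, up to an arbitrarily small loss. -/

theorem _root_.Matrix.PosSemidef.exists_eq_mul_conjTranspose {ι : Type*} [Fintype ι]
    {M : Matrix ι ι ℂ} (hM : M.PosSemidef) :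
    ∃ (m : ℕ) (C : Matrix ι (Fin m) ℂ), M = C * Cᴴ := by
  obtain ⟨m, v, rfl⟩ := Matrix.posSemidef_iff_eq_sum_vecMulVec.1 hM
  refine ⟨m, Matrix.of fun p i => v i p, ?_⟩
  ext p q
  simp [Matrix.sum_apply, Matrix.vecMulVec_apply, Matrix.mul_apply]

/-- Write `A = C C*` and take `b = C`, `c = C* A⁻¹ a`. When `A` is a term of `schurSeq`, the matrix
`c* c` is exactly what the recursion subtracts from `2s` to form the next term. -/
theorem _root_.Matrix.PosDef.exists_factor {ι : Type*} [Fintype ι] [DecidableEq ι]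
    {A : Matrix ι ι ℂ} (hA : A.PosDef) (a : Matrix ι ι ℂ) :
    ∃ (m : ℕ) (b : Matrix ι (Fin m) ℂ) (c : Matrix (Fin m) ι ℂ),
      b * c = a ∧ b * bᴴ = A ∧ cᴴ * c = aᴴ * A⁻¹ * a := by
  obtain ⟨m, C, hC⟩ := hA.posSemidef.exists_eq_mul_conjTranspose
  have hdet : IsUnit A.det := hA.isUnit.map Matrix.detMonoidHom
  have hherm : (A⁻¹)ᴴ = A⁻¹ := by rw [Matrix.conjTranspose_nonsing_inv, hA.isHermitian.eq]
  refine ⟨m, C, Cᴴ * A⁻¹ * a, ?_, hC.symm, ?_⟩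
  · rw [← Matrix.mul_assoc, ← Matrix.mul_assoc, ← hC, Matrix.mul_nonsing_inv _ hdet,
      Matrix.one_mul]
  · calc (Cᴴ * A⁻¹ * a)ᴴ * (Cᴴ * A⁻¹ * a) = aᴴ * ((A⁻¹)ᴴ * ((C * Cᴴ) * A⁻¹)) * a := by
          simp only [Matrix.conjTranspose_mul, Matrix.conjTranspose_conjTranspose,
            Matrix.mul_assoc]
      _ = _ := by rw [← hC, Matrix.mul_nonsing_inv _ hdet, hherm, Matrix.mul_one]

/-- An approximate form of Ando's factorization of the matrices of numerical radius at most `w`. -/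
theorem NumRadLE.exists_factor {ι : Type} [Fintype ι] [DecidableEq ι] {a : Matrix ι ι ℂ}
    {w s t : ℝ} (ha : NumRadLE a w) (hws : w < s) (hs : 0 < s) (hst : s < t) :
    ∃ (κ : Type) (_ : Fintype κ) (b : Matrix ι κ ℂ) (c : Matrix κ ι ℂ), b * c = a ∧
      (((2 * t : ℝ) : ℂ) • (1 : Matrix ι ι ℂ) - (b * bᴴ + cᴴ * c)).PosSemidef := by
  -- The telescoped average is at most `2s + 2s/N`, and `N (t - s) ≥ s` puts this below `2t`.
  obtain ⟨N, hN⟩ := exists_nat_gt (s / (t - s))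
  have hN0 : (0 : ℝ) < N := lt_trans (by have := sub_pos.2 hst; positivity) hN
  have hNt : s ≤ N * (t - s) := by
    have := (div_lt_iff₀ (sub_pos.2 hst)).1 hN
    linarith
  choose m b c hbc hb hc using fun k : ℕ => (ha.schurSeq_posDef hws k).exists_factor a
  -- Scaling both factors by `N^(-1/2)` turns the concatenation of the `N` factorizations into their
  -- average.
  set r : ℂ := (((√(N : ℝ))⁻¹ : ℝ) : ℂ) with hr
  have hrr : r * r = (((N : ℝ)⁻¹ : ℝ) : ℂ) := by
    rw [hr, ← Complex.ofReal_mul, ← mul_inv, Real.mul_self_sqrt hN0.le]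
  have hrs : star r = r := Complex.conj_ofReal _
  have hNc : (N : ℂ) ≠ 0 := by exact_mod_cast hN0.ne'
  refine ⟨(k : Fin N) × Fin (m k), inferInstance, Matrix.of fun i p => r * b p.1 i p.2,
    Matrix.of fun p j => r * c p.1 p.2 j, ?_, ?_⟩
  · ext i j
    have e : ∀ k : Fin N, ∑ p, r * b k i p * (r * c k p j) = (N : ℂ)⁻¹ * a i j := by
      intro k
      rw [← hbc k, Matrix.mul_apply, Finset.mul_sum]
      refine Finset.sum_congr rfl fun p _ => ?_
      push_cast at hrr
      linear_combination (b k i p * c k p j) * hrr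
    simp only [Matrix.mul_apply, Matrix.of_apply, Fintype.sum_sigma, e]
    simp [hNc]
  -- Positivity is proved for the explicit average; the two equations transport it to the product of
  -- the concatenated factors.
  · have e : ∀ i j, ((2 * t : ℝ) : ℂ) • (1 : Matrix ι ι ℂ) - (((N : ℝ)⁻¹ : ℝ) : ℂ) •
        (∑ k ∈ Finset.range N, (b k * (b k)ᴴ + (c k)ᴴ * c k)) = i → i = j → j.PosSemidef := by
      rintro _ _ rfl rfl
      -- The sum telescopes to `2sN + A₀ - A_N`, and `A₀ = 2s`.
      have hsum : ∑ k ∈ Finset.range N, (b k * (b k)ᴴ + (c k)ᴴ * c k) =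
          ((N : ℂ) * ((2 * s : ℝ) : ℂ)) • 1 + ((2 * s : ℝ) : ℂ) • 1 - schurSeq a s N := by
        have h1 : ∀ k, b k * (b k)ᴴ + (c k)ᴴ * c k =
            ((2 * s : ℝ) : ℂ) • 1 - (schurSeq a s (k + 1) - schurSeq a s k) := by
          intro k
          rw [hb, hc, schurSeq]
          abel
        simp only [h1]
        rw [Finset.sum_sub_distrib, Finset.sum_range_sub, Finset.sum_const, Finset.card_range,
          ← Nat.cast_smul_eq_nsmul ℂ, smul_smul, schurSeq]
        abel
      rw [hsum]
      have h2 : ((2 * t : ℝ) : ℂ) • (1 : Matrix ι ι ℂ) - (((N : ℝ)⁻¹ : ℝ) : ℂ) •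
          (((N : ℂ) * ((2 * s : ℝ) : ℂ)) • 1 + ((2 * s : ℝ) : ℂ) • 1 - schurSeq a s N) =
          (((N : ℝ)⁻¹ * (2 * (N * (t - s) - s)) : ℝ) : ℂ) • (1 : Matrix ι ι ℂ) +
            (((N : ℝ)⁻¹ : ℝ) : ℂ) • schurSeq a s N := by
        rw [smul_sub, ← add_smul, smul_smul, ← sub_add, ← sub_smul]
        congr 2
        push_cast
        field_simp
        ring
      rw [h2]
      refine (Matrix.PosSemidef.one.smul ?_).add ((ha.schurSeq_posDef hws N).posSemidef.smul ?_)
      · rw [Complex.zero_le_real]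
        have : 0 ≤ N * (t - s) - s := by linarith
        positivity
      · rw [Complex.zero_le_real]
        positivity
    refine e _ _ rfl ?_
    congr 1
    ext i j
    simp only [Matrix.smul_apply, Matrix.sum_apply, Matrix.add_apply, Matrix.mul_apply,
      Matrix.of_apply, Fintype.sum_sigma, Matrix.conjTranspose_apply, star_mul', hrs]
    rw [← Finset.sum_range (fun k => ∑ p, r * b k i p * (r * star (b k j p))),
      ← Finset.sum_range (fun k => ∑ p, r * star (c k p i) * (r * c k p j)),
      ← Finset.sum_add_distrib, smul_eq_mul, Finset.mul_sum]
    refine Finset.sum_congr rfl fun k _ => ?_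
    rw [mul_add, Finset.mul_sum, Finset.mul_sum, ← hrr]
    congr 1 <;> exact Finset.sum_congr rfl fun p _ => by ring

/-! ### Bounds for matrices of operators and scalars -/

section Bounds

variable {H : Type*} [NormedAddCommGroup H] [InnerProductSpace ℂ H]
variable {m n p q : Type*} [Fintype m] [Fintype n] [Fintype p] [Fintype q]

/-- The matrix `x` of operators has norm at most `√c`. -/
def OpBdd (x : Matrix m n (H →L[ℂ] H)) (c : ℝ) : Prop :=
  ∀ v : n → H, ∑ i, ‖∑ j, x i j (v j)‖ ^ 2 ≤ c * ∑ j, ‖v j‖ ^ 2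

theorem OpBdd.mono {x : Matrix m n (H →L[ℂ] H)} {c d : ℝ} (h : OpBdd x c) (hcd : c ≤ d) :
    OpBdd x d :=
  fun v => (h v).trans (by gcongr)

theorem OpBdd.submatrix {x : Matrix m n (H →L[ℂ] H)} {c : ℝ} (h : OpBdd x c) (e : p ≃ m)
    (f : q ≃ n) : OpBdd (x.submatrix e f) c := by
  intro v
  have := h (v ∘ f.symm)
  rw [← e.sum_comp, ← f.sum_comp (fun j => ‖(v ∘ f.symm) j‖ ^ 2)] at this
  simp only [← f.sum_comp (fun j => x _ j _)] at this
  simpa using this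

/-- With `v = x* w` one has `‖v‖² = ⟨w, x v⟩`, so Cauchy–Schwarz gives `‖v‖⁴ ≤ ‖w‖² c ‖v‖²`, and one
factor `‖v‖²` cancels. -/
theorem OpBdd.conjTranspose [CompleteSpace H] {x : Matrix m n (H →L[ℂ] H)} {c : ℝ}
    (h : OpBdd x c) (hc : 0 ≤ c) : OpBdd xᴴ c := by
  intro w
  set v : n → H := fun j => ∑ i, xᴴ j i (w i) with hv
  set S := ∑ j, ‖v j‖ ^ 2 with hS
  have hS0 : 0 ≤ S := by positivity
  have h1 : (S : ℂ) = ∑ i, inner ℂ (w i) (∑ j, x i j (v j)) := by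
    have e : ∀ j, ((‖v j‖ ^ 2 : ℝ) : ℂ) = ∑ i, inner ℂ (w i) (x i j (v j)) := by
      intro j
      have h2 : inner ℂ (v j) (v j) = ((‖v j‖ ^ 2 : ℝ) : ℂ) := by
        rw [inner_self_eq_norm_sq_to_K]; norm_cast
      rw [← h2]
      conv_lhs => enter [2]; rw [hv]
      rw [sum_inner]
      refine Finset.sum_congr rfl fun i _ => ?_
      rw [Matrix.conjTranspose_apply, ContinuousLinearMap.star_eq_adjoint,
        ContinuousLinearMap.adjoint_inner_left]
    rw [hS, Complex.ofReal_sum]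
    simp only [e, inner_sum]
    exact Finset.sum_comm
  have h2 : S ≤ ∑ i, ‖w i‖ * ‖∑ j, x i j (v j)‖ := by
    calc S = ‖(S : ℂ)‖ := by rw [Complex.norm_real, Real.norm_of_nonneg hS0]
      _ ≤ _ := by
        rw [h1]
        exact (norm_sum_le _ _).trans (Finset.sum_le_sum fun i _ => norm_inner_le_norm _ _)
  have h3 : S ^ 2 ≤ (∑ i, ‖w i‖ ^ 2) * (c * S) := by
    calc S ^ 2 ≤ (∑ i, ‖w i‖ * ‖∑ j, x i j (v j)‖) ^ 2 := by gcongr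
      _ ≤ (∑ i, ‖w i‖ ^ 2) * ∑ i, ‖∑ j, x i j (v j)‖ ^ 2 := Finset.sum_mul_sq_le_sq_mul_sq _ _ _
      _ ≤ _ := by gcongr; exact h v
  rcases hS0.eq_or_lt with h0 | h0
  · change S ≤ _
    rw [← h0]
    positivity
  · change S ≤ _
    have : S * S ≤ S * (c * ∑ i, ‖w i‖ ^ 2) := by nlinarith
    exact le_of_mul_le_mul_left this h0

theorem OpBdd.fromRows {x : Matrix m n (H →L[ℂ] H)} {y : Matrix p n (H →L[ℂ] H)} {c d : ℝ}
    (hx : OpBdd x c) (hy : OpBdd y d) : OpBdd (Matrix.fromRows x y) (c + d) := by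
  intro v
  rw [Fintype.sum_sum_type, add_mul]
  exact add_le_add (hx v) (hy v)

theorem OpBdd.fromCols [CompleteSpace H] {x : Matrix m n (H →L[ℂ] H)}
    {y : Matrix m p (H →L[ℂ] H)} {c d : ℝ} (hx : OpBdd x c) (hy : OpBdd y d) (hc : 0 ≤ c)
    (hd : 0 ≤ d) : OpBdd (Matrix.fromCols x y) (c + d) := by
  have := ((hx.conjTranspose hc).fromRows (hy.conjTranspose hd)).conjTranspose (by positivity)
  rwa [Matrix.conjTranspose_fromRows_eq_fromCols_conjTranspose, Matrix.conjTranspose_conjTranspose,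
    Matrix.conjTranspose_conjTranspose] at this

theorem OpBdd.fromBlocks_diag {x : Matrix m n (H →L[ℂ] H)} {y : Matrix p q (H →L[ℂ] H)} {c : ℝ}
    (hx : OpBdd x c) (hy : OpBdd y c) : OpBdd (Matrix.fromBlocks x 0 0 y) c := by
  intro v
  simp only [Fintype.sum_sum_type, mul_add]
  have h1 := hx fun j => v (Sum.inl j)
  have h2 := hy fun j => v (Sum.inr j)
  simpa using add_le_add h1 h2

theorem opBdd_opNorm {m n : ℕ} (x : Matrix (Fin m) (Fin n) (H →L[ℂ] H)) :
    OpBdd x (opNorm x ^ 2) := by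
  intro v
  have h := (matrixOp x).le_opNorm (WithLp.toLp 2 v)
  have h2 := pow_le_pow_left₀ (norm_nonneg _) h 2
  rw [mul_pow, PiLp.norm_sq_eq_of_L2, PiLp.norm_sq_eq_of_L2] at h2
  simpa [matrixOp, opNorm] using h2

theorem opNorm_nonneg {m n : ℕ} (x : Matrix (Fin m) (Fin n) (H →L[ℂ] H)) : 0 ≤ opNorm x :=
  norm_nonneg (matrixOp x)

theorem OpBdd.opNorm_le {m n : ℕ} {x : Matrix (Fin m) (Fin n) (H →L[ℂ] H)} {c : ℝ}
    (h : OpBdd x c) (hc : 0 ≤ c) : opNorm x ≤ √c := by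
  refine ContinuousLinearMap.opNorm_le_bound _ (Real.sqrt_nonneg _) fun v => ?_
  refine le_of_sq_le_sq ?_ (by positivity)
  rw [mul_pow, PiLp.norm_sq_eq_of_L2, PiLp.norm_sq_eq_of_L2, Real.sq_sqrt hc]
  simpa [matrixOp] using h v.ofLp

theorem OpBdd.opNorm_sq_le {m n : ℕ} {x : Matrix (Fin m) (Fin n) (H →L[ℂ] H)} {c : ℝ}
    (h : OpBdd x c) (hc : 0 ≤ c) : opNorm x ^ 2 ≤ c := by
  calc opNorm x ^ 2 ≤ √c ^ 2 := pow_le_pow_left₀ (opNorm_nonneg x) (h.opNorm_le hc) 2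
    _ = c := Real.sq_sqrt hc

theorem opNorm_conjTranspose_mul_self_le [CompleteSpace H] {n : ℕ}
    {z : Matrix m (Fin n) (H →L[ℂ] H)} {c : ℝ} (h : OpBdd z c) (hc : 0 ≤ c) :
    opNorm (zᴴ * z) ≤ c := by
  have : OpBdd (zᴴ * z) (c ^ 2) := by
    intro v
    have h1 := h.conjTranspose hc fun i => ∑ j, z i j (v j)
    have h2 : ∀ i, ∑ j, (zᴴ * z) i j (v j) = ∑ k, zᴴ i k (∑ j, z k j (v j)) := by
      intro i
      simp only [Matrix.mul_apply, sum_apply, mul_apply_eq_comp,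
        map_sum]
      exact Finset.sum_comm
    simp only [h2]
    refine h1.trans ?_
    rw [pow_two, mul_assoc]
    exact mul_le_mul_of_nonneg_left (h v) hc
  simpa [Real.sqrt_sq hc] using this.opNorm_le (by positivity)

/-- The nontrivial half of the C*-identity for rectangular matrices: `‖z v‖² = ⟨v, z* z v⟩`. -/
theorem opBdd_of_opNorm_conjTranspose_mul_self [CompleteSpace H] {n : ℕ}
    (z : Matrix m (Fin n) (H →L[ℂ] H)) : OpBdd z (opNorm (zᴴ * z)) := by
  intro v
  have h1 := opBdd_opNorm (zᴴ * z) v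
  set P : Fin n → H := fun i => ∑ j, (zᴴ * z) i j (v j) with hP
  set S := ∑ i, ‖∑ j, z i j (v j)‖ ^ 2 with hS
  have hS0 : 0 ≤ S := by positivity
  have h2 : (S : ℂ) = ∑ i, inner ℂ (v i) (P i) := by
    have e : ∀ k, ((‖∑ j, z k j (v j)‖ ^ 2 : ℝ) : ℂ) =
        ∑ i, inner ℂ (v i) (zᴴ i k (∑ j, z k j (v j))) := by
      intro k
      have h2 : inner ℂ (∑ j, z k j (v j)) (∑ j, z k j (v j)) =
          ((‖∑ j, z k j (v j)‖ ^ 2 : ℝ) : ℂ) := by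
        rw [inner_self_eq_norm_sq_to_K]; norm_cast
      rw [← h2]
      conv_lhs => rw [sum_inner]
      refine Finset.sum_congr rfl fun i _ => ?_
      rw [Matrix.conjTranspose_apply, ContinuousLinearMap.star_eq_adjoint,
        ContinuousLinearMap.adjoint_inner_right]
    rw [hS, Complex.ofReal_sum]
    simp only [e]
    rw [Finset.sum_comm]
    refine Finset.sum_congr rfl fun i _ => ?_
    rw [← inner_sum]
    congr 1
    simp only [hP, Matrix.mul_apply, sum_apply, mul_apply_eq_comp,
      map_sum]
    exact Finset.sum_comm
  have h3 : S ≤ ∑ i, ‖v i‖ * ‖P i‖ := by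
    calc S = ‖(S : ℂ)‖ := by rw [Complex.norm_real, Real.norm_of_nonneg hS0]
      _ ≤ _ := by
        rw [h2]
        exact (norm_sum_le _ _).trans (Finset.sum_le_sum fun i _ => norm_inner_le_norm _ _)
  have h4 : S ^ 2 ≤ (opNorm (zᴴ * z) * ∑ j, ‖v j‖ ^ 2) ^ 2 := by
    calc S ^ 2 ≤ (∑ i, ‖v i‖ * ‖P i‖) ^ 2 := by gcongr
      _ ≤ (∑ i, ‖v i‖ ^ 2) * ∑ i, ‖P i‖ ^ 2 := Finset.sum_mul_sq_le_sq_mul_sq _ _ _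
      _ ≤ (∑ i, ‖v i‖ ^ 2) * (opNorm (zᴴ * z) ^ 2 * ∑ j, ‖v j‖ ^ 2) := by gcongr
      _ = _ := by ring
  exact le_of_sq_le_sq h4 (mul_nonneg (opNorm_nonneg _) (by positivity))

/-- The scalar matrix `α` has norm at most `√c`. -/
def ScalarBdd (α : Matrix m n ℂ) (c : ℝ) : Prop :=
  ∀ ξ : n → ℂ, ∑ i, ‖(α *ᵥ ξ) i‖ ^ 2 ≤ c * ∑ j, ‖ξ j‖ ^ 2

theorem sum_norm_sq_sum_smul (β : Matrix m n ℂ) (h : n → H) :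
    ((∑ i, ‖∑ j, β i j • h j‖ ^ 2 : ℝ) : ℂ) = ∑ j, ∑ k, (βᴴ * β) j k * inner ℂ (h j) (h k) := by
  have e : ∀ i, ((‖∑ j, β i j • h j‖ ^ 2 : ℝ) : ℂ) =
      ∑ j, ∑ k, star (β i j) * β i k * inner ℂ (h j) (h k) := by
    intro i
    have h2 : inner ℂ (∑ j, β i j • h j) (∑ j, β i j • h j) =
        ((‖∑ j, β i j • h j‖ ^ 2 : ℝ) : ℂ) := by
      rw [inner_self_eq_norm_sq_to_K]; norm_cast
    rw [← h2]
    simp only [sum_inner, inner_sum, inner_smul_left, inner_smul_right, Finset.mul_sum]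
    rw [Finset.sum_comm]
    refine Finset.sum_congr rfl fun j _ => Finset.sum_congr rfl fun k _ => ?_
    rw [← mul_assoc, mul_comm (β i k)]
    rfl
  rw [Complex.ofReal_sum]
  simp only [e, Matrix.mul_apply, Matrix.conjTranspose_apply, Finset.sum_mul]
  rw [Finset.sum_comm]
  exact Finset.sum_congr rfl fun j _ => Finset.sum_comm

/-- Scalar bounds survive tensoring with the identity of `H`: writing `c - β* β = C C*`, the
difference of the two sides is `‖C* h‖²`. -/
theorem sum_norm_sq_le_of_posSemidef [DecidableEq n] {β : Matrix m n ℂ} {c : ℝ}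
    (hβ : ((c : ℂ) • (1 : Matrix n n ℂ) - βᴴ * β).PosSemidef) (h : n → H) :
    ∑ i, ‖∑ j, β i j • h j‖ ^ 2 ≤ c * ∑ j, ‖h j‖ ^ 2 := by
  obtain ⟨r, C, hC⟩ := hβ.exists_eq_mul_conjTranspose
  have h1 := sum_norm_sq_sum_smul β h
  have h2 := sum_norm_sq_sum_smul Cᴴ h
  have h3 := sum_norm_sq_sum_smul (1 : Matrix n n ℂ) h
  rw [Matrix.conjTranspose_conjTranspose, ← hC] at h2
  have h4 : ((∑ i, ‖∑ j, β i j • h j‖ ^ 2 + ∑ i, ‖∑ j, Cᴴ i j • h j‖ ^ 2 : ℝ) : ℂ) =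
      ((c * ∑ j, ‖∑ k, (1 : Matrix n n ℂ) j k • h k‖ ^ 2 : ℝ) : ℂ) := by
    rw [Complex.ofReal_add, Complex.ofReal_mul, h1, h2, h3, ← Finset.sum_add_distrib,
      Finset.mul_sum]
    refine Finset.sum_congr rfl fun j _ => ?_
    rw [← Finset.sum_add_distrib, Finset.mul_sum]
    refine Finset.sum_congr rfl fun k _ => ?_
    simp only [Matrix.sub_apply, Matrix.smul_apply, smul_eq_mul, Matrix.conjTranspose_one,
      Matrix.one_mul]
    ring
  have h5 := Complex.ofReal_injective h4
  have h6 : ∀ j, ∑ k, (1 : Matrix n n ℂ) j k • h k = h j := by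
    intro j
    simp [Matrix.one_apply]
  simp only [h6] at h5
  have : 0 ≤ ∑ i, ‖∑ j, Cᴴ i j • h j‖ ^ 2 := by positivity
  linarith

theorem ScalarBdd.posSemidef [DecidableEq n] {α : Matrix m n ℂ} {c : ℝ} (h : ScalarBdd α c) :
    ((c : ℂ) • (1 : Matrix n n ℂ) - αᴴ * α).PosSemidef := by
  refine Matrix.PosSemidef.of_dotProduct_mulVec_nonneg ?_ fun ξ => ?_
  · refine Matrix.IsHermitian.sub ?_ (Matrix.isHermitian_conjTranspose_mul_self α)
    rw [Matrix.IsHermitian, Matrix.conjTranspose_smul, Matrix.conjTranspose_one]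
    simp
  · have e : star ξ ⬝ᵥ (((c : ℂ) • (1 : Matrix n n ℂ) - αᴴ * α) *ᵥ ξ) =
        ((c * ∑ j, ‖ξ j‖ ^ 2 - ∑ i, ‖(α *ᵥ ξ) i‖ ^ 2 : ℝ) : ℂ) := by
      rw [Matrix.sub_mulVec, dotProduct_sub, Matrix.smul_mulVec, Matrix.one_mulVec,
        dotProduct_smul, star_dotProduct_self, ← Matrix.mulVec_mulVec, Matrix.dotProduct_mulVec,
        ← Matrix.star_mulVec, star_dotProduct_self, smul_eq_mul]
      push_cast
      rfl
    rw [e, Complex.zero_le_real]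
    exact sub_nonneg.2 (h ξ)

theorem ScalarBdd.sum_norm_sq_le {α : Matrix m n ℂ} {c : ℝ} (hα : ScalarBdd α c) (h : n → H) :
    ∑ i, ‖∑ j, α i j • h j‖ ^ 2 ≤ c * ∑ j, ‖h j‖ ^ 2 := by
  classical
  exact sum_norm_sq_le_of_posSemidef hα.posSemidef h

theorem scalarBdd_scalarNorm {m n : ℕ} (α : Matrix (Fin m) (Fin n) ℂ) :
    ScalarBdd α (scalarNorm α ^ 2) := by
  intro ξ
  have h := pow_le_pow_left₀ (norm_nonneg _)
    (Matrix.l2_opNorm_mulVec α (WithLp.toLp 2 ξ)) 2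
  rw [mul_pow, PiLp.norm_sq_eq_of_L2, PiLp.norm_sq_eq_of_L2] at h
  exact h

theorem ScalarBdd.scalarNorm_le {m n : ℕ} {α : Matrix (Fin m) (Fin n) ℂ} {c : ℝ}
    (h : ScalarBdd α (c ^ 2)) (hc : 0 ≤ c) : scalarNorm α ≤ c := by
  rw [scalarNorm, Matrix.l2_opNorm_def]
  refine ContinuousLinearMap.opNorm_le_bound _ hc fun v => ?_
  refine le_of_sq_le_sq ?_ (by positivity)
  rw [mul_pow, PiLp.norm_sq_eq_of_L2, PiLp.norm_sq_eq_of_L2]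
  exact h v.ofLp

theorem scalarNorm_nonneg {m n : ℕ} (α : Matrix (Fin m) (Fin n) ℂ) : 0 ≤ scalarNorm α := by
  rw [scalarNorm, Matrix.l2_opNorm_def]
  exact norm_nonneg _

theorem scalarNorm_conjTranspose {m n : ℕ} (α : Matrix (Fin m) (Fin n) ℂ) :
    scalarNorm αᴴ = scalarNorm α :=
  Matrix.l2_opNorm_conjTranspose α

theorem ScalarBdd.submatrix {α : Matrix m n ℂ} {c : ℝ} (h : ScalarBdd α c) (e : p ≃ m)
    (f : q ≃ n) : ScalarBdd (α.submatrix e f) c := by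
  intro ξ
  have := h (ξ ∘ f.symm)
  rw [← e.sum_comp, ← f.sum_comp (fun j => ‖(ξ ∘ f.symm) j‖ ^ 2)] at this
  simpa [Matrix.submatrix_mulVec_equiv] using this

theorem ScalarBdd.fromBlocks_diag {α : Matrix m n ℂ} {β : Matrix p q ℂ} {c : ℝ}
    (hα : ScalarBdd α c) (hβ : ScalarBdd β c) : ScalarBdd (Matrix.fromBlocks α 0 0 β) c := by
  intro ξ
  have h1 := hα fun j => ξ (Sum.inl j)
  have h2 := hβ fun j => ξ (Sum.inr j)
  simpa [Fintype.sum_sum_type, mul_add, Matrix.mulVec, dotProduct] using add_le_add h1 h2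

/-! ### The numerical radius of scalar matrices. -/

theorem NumRadLE.submatrix {a : Matrix m m ℂ} {w : ℝ} (h : NumRadLE a w) (e : p ≃ m) :
    NumRadLE (a.submatrix e e) w := by
  intro ξ
  have := h (ξ ∘ e.symm)
  rw [← e.sum_comp] at this
  have h2 : star ξ ⬝ᵥ (a.submatrix e e *ᵥ ξ) = star (ξ ∘ e.symm) ⬝ᵥ (a *ᵥ (ξ ∘ e.symm)) := by
    rw [Matrix.submatrix_mulVec_equiv]
    simp only [dotProduct]
    rw [← e.sum_comp]
    simp
  rw [h2]
  simpa using this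

theorem numRadLE_numericalRadius {n : ℕ} (a : Matrix (Fin n) (Fin n) ℂ) :
    NumRadLE a (numericalRadius a) := by
  intro ξ
  have hbdd : BddAbove (Set.range fun ξ : {ξ : EuclideanSpace ℂ (Fin n) // ‖ξ‖ = 1} =>
      ‖inner ℂ (Matrix.toEuclideanCLM (n := Fin n) (𝕜 := ℂ) a ξ.1) ξ.1‖) := by
    refine ⟨‖Matrix.toEuclideanCLM (n := Fin n) (𝕜 := ℂ) a‖, ?_⟩
    rintro _ ⟨ξ, rfl⟩
    refine (norm_inner_le_norm _ _).trans ?_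
    rw [ξ.2, mul_one]
    simpa [ξ.2] using (Matrix.toEuclideanCLM (n := Fin n) (𝕜 := ℂ) a).le_opNorm ξ.1
  set v : EuclideanSpace ℂ (Fin n) := WithLp.toLp 2 ξ with hv
  have hn : ∑ i, ‖ξ i‖ ^ 2 = ‖v‖ ^ 2 := by rw [PiLp.norm_sq_eq_of_L2]
  have hi : ∀ v : EuclideanSpace ℂ (Fin n),
      ‖inner ℂ (Matrix.toEuclideanCLM (n := Fin n) (𝕜 := ℂ) a v) v‖ =
      ‖star v.ofLp ⬝ᵥ (a *ᵥ v.ofLp)‖ := by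
    intro v
    rw [norm_inner_symm, EuclideanSpace.inner_eq_star_dotProduct, dotProduct_comm]
    rfl
  rcases eq_or_ne v 0 with h0 | h0
  · have : ξ = 0 := by simpa [hv] using h0
    simp [this]
  · have hvn : ‖v‖ ≠ 0 := norm_ne_zero_iff.2 h0
    have h1 := le_ciSup hbdd ⟨((‖v‖⁻¹ : ℝ) : ℂ) • v, by
      rw [norm_smul, Complex.norm_real, norm_inv, norm_norm, inv_mul_cancel₀ hvn]⟩
    change _ ≤ numericalRadius a at h1
    simp only [map_smul, inner_smul_left, inner_smul_right, norm_mul, RCLike.norm_conj, hi,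
      Complex.norm_real, norm_inv, norm_norm] at h1
    rw [hn]
    have h2 : ‖star ξ ⬝ᵥ (a *ᵥ ξ)‖ =
        (‖v‖⁻¹ * (‖v‖⁻¹ * ‖star v.ofLp ⬝ᵥ (a *ᵥ v.ofLp)‖)) * ‖v‖ ^ 2 := by
      change _ = (‖v‖⁻¹ * (‖v‖⁻¹ * ‖star ξ ⬝ᵥ (a *ᵥ ξ)‖)) * ‖v‖ ^ 2
      field_simp
    rw [h2]
    gcongr

theorem NumRadLE.numericalRadius_le {n : ℕ} {a : Matrix (Fin n) (Fin n) ℂ} {w : ℝ}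
    (h : NumRadLE a w) (hw : 0 ≤ w) : numericalRadius a ≤ w := by
  -- For `n = 0` the unit sphere is empty and the supremum is `0`, hence the need for `0 ≤ w`.
  refine Real.iSup_le (fun ξ => ?_) hw
  rw [norm_inner_symm, EuclideanSpace.inner_eq_star_dotProduct, dotProduct_comm]
  refine (h ξ.1.ofLp).trans ?_
  rw [← PiLp.norm_sq_eq_of_L2 (fun _ : Fin n => ℂ), ξ.2]
  simp

theorem numericalRadius_nonneg {n : ℕ} (a : Matrix (Fin n) (Fin n) ℂ) : 0 ≤ numericalRadius a :=
  Real.iSup_nonneg fun _ => norm_nonneg _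

/-- The nilpotent block matrix `[[0, 1], [0, 0]]` is a contraction. -/
theorem scalarBdd_nilpotent [DecidableEq n] :
    ScalarBdd (Matrix.fromBlocks 0 1 0 0 : Matrix (n ⊕ n) (n ⊕ n) ℂ) 1 := by
  intro ξ
  have : 0 ≤ ∑ j, ‖ξ (Sum.inl j)‖ ^ 2 := by positivity
  simpa [Fintype.sum_sum_type, Matrix.mulVec, dotProduct, Matrix.one_apply] using this

theorem numRadLE_nilpotent [DecidableEq n] :
    NumRadLE (Matrix.fromBlocks 0 1 0 0 : Matrix (n ⊕ n) (n ⊕ n) ℂ) (1 / 2) := by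
  intro ξ
  have e : star ξ ⬝ᵥ ((Matrix.fromBlocks 0 1 0 0 : Matrix (n ⊕ n) (n ⊕ n) ℂ) *ᵥ ξ) =
      ∑ j, star (ξ (Sum.inl j)) * ξ (Sum.inr j) := by
    simp [Fintype.sum_sum_type, Matrix.mulVec, dotProduct, Matrix.one_apply]
  rw [e, Fintype.sum_sum_type, ← Finset.sum_add_distrib, Finset.mul_sum]
  refine (norm_sum_le _ _).trans (Finset.sum_le_sum fun j _ => ?_)
  rw [norm_mul, norm_star]
  nlinarith [sq_nonneg (‖ξ (Sum.inl j)‖ - ‖ξ (Sum.inr j)‖)]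

end Bounds

/-! ### Factorizations of matrices over tensor products -/

section Factorizations

variable {H : Type*} [NormedAddCommGroup H] [InnerProductSpace ℂ H]
variable {X Y : Submodule ℂ (H →L[ℂ] H)}
variable {m n p q ι κ : Type*}

/-- `toOp` for arbitrary index types. -/
def opMatrix (x : Matrix m n X) : Matrix m n (H →L[ℂ] H) := x.map Subtype.val

/-- `odot` for arbitrary index types. -/
def dot [Fintype ι] (x : Matrix m ι X) (y : Matrix ι n Y) : Matrix m n (X ⊗[ℂ] Y) :=
  Matrix.of fun i j => ∑ k, x i k ⊗ₜ[ℂ] y k j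

/-- `rightMul` for arbitrary index types. -/
def mulScalar [Fintype ι] (x : Matrix m ι X) (a : Matrix ι n ℂ) : Matrix m n X :=
  Matrix.of fun i j => ∑ k, a k j • x i k

/-- The product of a scalar matrix with a matrix over `X`. -/
def scalarMul [Fintype m] (α : Matrix p m ℂ) (x : Matrix m n X) : Matrix p n X :=
  Matrix.of fun i j => ∑ k, α i k • x k j

section Algebra

variable [Fintype ι]

theorem dot_submatrix [Fintype κ] (x : Matrix m ι X) (y : Matrix ι n Y) (e : κ ≃ ι) (f : p → m) (g : q → n) :
    dot (x.submatrix f e) (y.submatrix e g) = (dot x y).submatrix f g := by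
  ext i j
  simp only [dot, Matrix.submatrix_apply, Matrix.of_apply]
  exact e.sum_comp fun k => x (f i) k ⊗ₜ[ℂ] y k (g j)

theorem dot_fromCols_fromRows [Fintype κ] (x : Matrix m ι X) (x' : Matrix m κ X) (y : Matrix ι n Y)
    (y' : Matrix κ n Y) :
    dot (Matrix.fromCols x x') (Matrix.fromRows y y') = dot x y + dot x' y' := by
  ext i j
  simp [dot, Fintype.sum_sum_type]

theorem dot_fromBlocks_diag [Fintype κ] (x : Matrix m ι X) (x' : Matrix p κ X) (y : Matrix ι n Y)
    (y' : Matrix κ q Y) :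
    dot (Matrix.fromBlocks x 0 0 x') (Matrix.fromBlocks y 0 0 y') =
      Matrix.fromBlocks (dot x y) 0 0 (dot x' y') := by
  ext (i | i) (j | j) <;> simp [dot, Fintype.sum_sum_type]

theorem dot_smul_smul (a b : ℂ) (x : Matrix m ι X) (y : Matrix ι n Y) :
    dot (a • x) (b • y) = (a * b) • dot x y := by
  ext i j
  simp only [dot, Matrix.of_apply, Matrix.smul_apply, TensorProduct.smul_tmul_smul,
    Finset.smul_sum]

theorem dot_scalarMul_mulScalar [Fintype m] [Fintype n] (α : Matrix p m ℂ) (x : Matrix m ι X) (y : Matrix ι n Y)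
    (β : Matrix n q ℂ) :
    dot (scalarMul α x) (mulScalar y β) =
      Matrix.of fun i j => ∑ k, ∑ l, (α i k * β l j) • dot x y k l := by
  ext i j
  have e : ∀ c : ι, (∑ k, α i k • x k c) ⊗ₜ[ℂ] (∑ l, β l j • y c l) =
      ∑ k, ∑ l, (α i k * β l j) • (x k c ⊗ₜ[ℂ] y c l) := by
    intro c
    simp only [TensorProduct.sum_tmul, TensorProduct.tmul_sum, TensorProduct.smul_tmul_smul]
    exact Finset.sum_comm
  simp only [dot, scalarMul, mulScalar, Matrix.of_apply, e, Finset.smul_sum]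
  rw [Finset.sum_comm]
  exact Finset.sum_congr rfl fun k _ => Finset.sum_comm

/-- Scalars pass through the tensor sign; this moves the right factor of `a = b c` from `x a` over
to `x*`. -/
theorem dot_mulScalar [Fintype κ] (x : Matrix m ι X) (b : Matrix ι κ ℂ) (y : Matrix κ n Y) :
    dot (mulScalar x b) y = dot x (scalarMul b y) := by
  ext i j
  simp only [dot, scalarMul, mulScalar, Matrix.of_apply, TensorProduct.sum_tmul,
    TensorProduct.tmul_sum, TensorProduct.smul_tmul, TensorProduct.tmul_smul]
  exact Finset.sum_comm

theorem mulScalar_mul [Fintype κ] (x : Matrix m ι X) (b : Matrix ι κ ℂ) (c : Matrix κ n ℂ) :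
    mulScalar x (b * c) = mulScalar (mulScalar x b) c := by
  ext1 i j
  simp only [mulScalar, Matrix.of_apply, Matrix.mul_apply, Finset.sum_smul, Finset.smul_sum,
    smul_smul]
  rw [Finset.sum_comm]
  simp only [mul_comm]

theorem scalarMul_mulScalar [Fintype m] (α : Matrix p m ℂ) (x : Matrix m ι X) (b : Matrix ι n ℂ) :
    mulScalar (scalarMul α x) b = scalarMul α (mulScalar x b) := by
  ext1 i j
  simp only [mulScalar, scalarMul, Matrix.of_apply, Finset.smul_sum, smul_smul]
  rw [Finset.sum_comm]
  simp only [mul_comm]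

end Algebra

theorem exists_eq_dot [Finite m] [Finite n] (u : Matrix m n (X ⊗[ℂ] Y)) :
    ∃ (ι : Type) (_ : Fintype ι) (x : Matrix m ι X) (y : Matrix ι n Y), u = dot x y := by
  classical
  induction u using Matrix.induction_on' with
  | h_zero => exact ⟨Empty, inferInstance, 0, 0, by ext; simp [dot]⟩
  | h_add u v hu hv =>
    obtain ⟨ι, _, x, y, rfl⟩ := hu
    obtain ⟨κ, _, x', y', rfl⟩ := hv
    exact ⟨ι ⊕ κ, inferInstance, Matrix.fromCols x x', Matrix.fromRows y y',
      (dot_fromCols_fromRows x x' y y').symm⟩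
  | h_std_basis i j t =>
    induction t using TensorProduct.induction_on with
    | zero => exact ⟨Empty, inferInstance, 0, 0, by ext; simp [dot]⟩
    | tmul a b =>
      refine ⟨Unit, inferInstance, Matrix.of fun k _ => if i = k then a else 0,
        Matrix.of fun _ l => if j = l then b else 0, ?_⟩
      ext k l
      by_cases hk : i = k <;> by_cases hl : j = l <;> simp [dot, hk, hl]
    | add s t hs ht =>
      obtain ⟨ι, _, x, y, h1⟩ := hs
      obtain ⟨κ, _, x', y', h2⟩ := ht
      refine ⟨ι ⊕ κ, inferInstance, Matrix.fromCols x x', Matrix.fromRows y y', ?_⟩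
      rw [dot_fromCols_fromRows, ← h1, ← h2, Matrix.single_add]

theorem sum_opMatrix_mulScalar [Fintype n] [Fintype p] (x : Matrix m n X) (β : Matrix n p ℂ) (v : p → H) (i : m) :
    ∑ j, opMatrix (mulScalar x β) i j (v j) = ∑ k, opMatrix x i k (∑ j, β k j • v j) := by
  simp only [opMatrix, mulScalar, Matrix.map_apply, Matrix.of_apply, Submodule.coe_sum,
    Submodule.coe_smul, sum_apply, smul_apply, map_sum, map_smul]
  exact Finset.sum_comm

section Bounds

variable [Fintype m] [Fintype n] [Fintype p]

theorem OpBdd.smul {x : Matrix m n X} {c : ℝ} (h : OpBdd (opMatrix x) c) (z : ℂ) :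
    OpBdd (opMatrix (z • x)) (‖z‖ ^ 2 * c) := by
  intro v
  have h1 := h v
  have e : ∀ i, ∑ j, opMatrix (z • x) i j (v j) = z • ∑ j, opMatrix x i j (v j) := by
    intro i
    simp [opMatrix, Finset.smul_sum]
  simp only [e, norm_smul, mul_pow, ← Finset.mul_sum, mul_assoc]
  gcongr

theorem OpBdd.scalarMul {x : Matrix m n X} {c a : ℝ} (h : OpBdd (opMatrix x) c)
    {α : Matrix p m ℂ} (hα : ScalarBdd α a) (ha : 0 ≤ a) :
    OpBdd (opMatrix (scalarMul α x)) (a * c) := by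
  intro v
  have e : ∀ i, ∑ j, opMatrix (NumRadiusOp.scalarMul α x) i j (v j) =
      ∑ k, α i k • ∑ j, opMatrix x k j (v j) := by
    intro i
    simp only [opMatrix, NumRadiusOp.scalarMul, Matrix.map_apply, Matrix.of_apply,
      Submodule.coe_sum, Submodule.coe_smul, sum_apply, smul_apply, Finset.smul_sum]
    exact Finset.sum_comm
  simp only [e]
  refine (hα.sum_norm_sq_le _).trans ?_
  rw [mul_assoc]
  exact mul_le_mul_of_nonneg_left (h v) ha

theorem OpBdd.mulScalar {x : Matrix m n X} {c b : ℝ} (h : OpBdd (opMatrix x) c) (hc : 0 ≤ c)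
    {β : Matrix n p ℂ} (hβ : ScalarBdd β b) : OpBdd (opMatrix (mulScalar x β)) (b * c) := by
  intro v
  simp only [sum_opMatrix_mulScalar]
  refine (h _).trans ?_
  rw [mul_comm b, mul_assoc]
  exact mul_le_mul_of_nonneg_left (hβ.sum_norm_sq_le v) hc

end Bounds

theorem opMatrix_fromBlocks_diag (x : Matrix m n X) (y : Matrix p q X) :
    opMatrix (Matrix.fromBlocks x 0 0 y) = Matrix.fromBlocks (opMatrix x) 0 0 (opMatrix y) := by
  ext (i | i) (j | j) <;> rfl

theorem opMatrix_fromCols (x : Matrix m n X) (y : Matrix m q X) :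
    opMatrix (Matrix.fromCols x y) = Matrix.fromCols (opMatrix x) (opMatrix y) := by
  ext i (j | j) <;> rfl

theorem opMatrix_fromRows (x : Matrix m n X) (y : Matrix p n X) :
    opMatrix (Matrix.fromRows x y) = Matrix.fromRows (opMatrix x) (opMatrix y) := by
  ext (i | i) j <;> rfl

end Factorizations

/-! ### Norms given by factorizations -/

section Gauge

variable {V : Type*} [AddCommGroup V] [Module ℂ V]

theorem le_const_mul_of_forall_lt {a b k : ℝ} (hk : 0 ≤ k) (h : ∀ c, b < c → a ≤ k * c) :
    a ≤ k * b := by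
  refine le_of_forall_pos_le_add fun ε hε => ?_
  -- Dividing by `k + 1` rather than `k` also covers `k = 0`.
  refine (h (b + ε / (k + 1)) (by linarith [show 0 < ε / (k + 1) by positivity])).trans ?_
  have : k * (ε / (k + 1)) ≤ ε := by
    rw [← mul_div_assoc, div_le_iff₀ (by positivity)]
    nlinarith
  linarith

/-- The matrix of the selection of the rows given by `f`. -/
def selection {k l : ℕ} (f : Fin k → Fin l) : Matrix (Fin k) (Fin l) ℂ :=
  (1 : Matrix (Fin l) (Fin l) ℂ).submatrix f id

theorem sandwich_selection {k l m n : ℕ} (f : Fin k → Fin l) (g : Fin n → Fin m)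
    (x : Matrix (Fin l) (Fin m) V) :
    sandwich (selection f) x (selection g)ᴴ = x.submatrix f g := by
  ext i j
  simp [sandwich, selection, Matrix.one_apply]

theorem scalarNorm_selection_le {k l : ℕ} {f : Fin k → Fin l} (hf : Function.Injective f) :
    scalarNorm (selection f) ≤ 1 := by
  refine ScalarBdd.scalarNorm_le (fun ξ => ?_) zero_le_one
  have e : ∀ i, (selection f *ᵥ ξ) i = ξ (f i) := by
    intro i
    simp [selection, Matrix.mulVec, dotProduct, Matrix.one_apply]
  simp only [e, one_pow, one_mul]
  rw [← Finset.sum_image (f := fun j => ‖ξ j‖ ^ 2) (s := Finset.univ) (g := f) hf.injOn]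
  exact Finset.sum_le_sum_of_subset_of_nonneg (Finset.subset_univ _) fun _ _ _ => by positivity

omit [Module ℂ V] in
theorem diagBlock_submatrix_castAdd {m n : ℕ} (x : Matrix (Fin m) (Fin m) V)
    (y : Matrix (Fin n) (Fin n) V) :
    (diagBlock x y).submatrix (Fin.castAdd n) (Fin.castAdd n) = x := by
  ext i j
  simp [diagBlock]

omit [Module ℂ V] in
theorem diagBlock_submatrix_natAdd {m n : ℕ} (x : Matrix (Fin m) (Fin m) V)
    (y : Matrix (Fin n) (Fin n) V) :
    (diagBlock x y).submatrix (Fin.natAdd m) (Fin.natAdd m) = y := by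
  ext i j
  simp [diagBlock]

omit [Module ℂ V] in
theorem cornerBlock_submatrix {n : ℕ} (x : Matrix (Fin n) (Fin n) V) :
    (cornerBlock x).submatrix (Fin.castAdd n) (Fin.natAdd n) = x := by
  ext i j
  simp only [cornerBlock, Matrix.submatrix_apply, Matrix.reindex_apply,
    finSumFinEquiv_symm_apply_castAdd, finSumFinEquiv_symm_apply_natAdd, Matrix.fromBlocks_apply₁₂]

/-- A family of functions given as infima of factorization bounds is a numerical radius norm when
the factorizations can be added, scaled, put on a diagonal and compressed. -/
theorem isNumericalRadiusSpace_of_factorization {N : MatrixFun V}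
    (F : ∀ n, Matrix (Fin n) (Fin n) V → ℝ → Prop)
    (nonneg : ∀ n x, 0 ≤ N n x)
    (le_of_fac : ∀ n x c, 0 ≤ c → F n x c → N n x ≤ c)
    (fac_of_lt : ∀ n x c, N n x < c → F n x c)
    (add : ∀ n x y c d, 0 ≤ c → 0 ≤ d → F n x c → F n y d → F n (x + y) (c + d))
    (smul : ∀ n (z : ℂ) x c, F n x c → F n (z • x) (‖z‖ * c))
    (diag : ∀ m n x y c, F m x c → F n y c → F (m + n) (diagBlock x y) c)
    (sandwich_le : ∀ m n (α : Matrix (Fin n) (Fin m) ℂ) x c, 0 ≤ c → F m x c →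
      F n (sandwich α x αᴴ) (scalarNorm α ^ 2 * c))
    (eq_zero : ∀ n x, N n x = 0 → x = 0) : IsNumericalRadiusSpace N := by
  have smul_le : ∀ n (z : ℂ) x, N n (z • x) ≤ ‖z‖ * N n x := by
    intro n z x
    refine le_const_mul_of_forall_lt (norm_nonneg z) fun c hc => ?_
    have hc0 : 0 ≤ c := (nonneg n x).trans hc.le
    exact le_of_fac _ _ _ (by positivity) (smul n z x c (fac_of_lt n x c hc))
  have sand : ∀ m n (α : Matrix (Fin n) (Fin m) ℂ) x,
      N n (sandwich α x αᴴ) ≤ scalarNorm α ^ 2 * N m x := by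
    intro m n α x
    refine le_const_mul_of_forall_lt (by positivity) fun c hc => ?_
    have hc0 : 0 ≤ c := (nonneg m x).trans hc.le
    exact le_of_fac _ _ _ (by positivity) (sandwich_le m n α x c hc0 (fac_of_lt m x c hc))
  -- Compression to a set of coordinates is a sandwich with a contraction; this gives the lower
  -- bound in the diagonal axiom.
  have sub : ∀ (k l : ℕ) (f : Fin k → Fin l) (x : Matrix (Fin l) (Fin l) V),
      Function.Injective f → N k (x.submatrix f f) ≤ N l x := by
    intro k l f x hf
    rw [← sandwich_selection]
    refine (sand _ _ _ _).trans ?_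
    have h1 : scalarNorm (selection f) ^ 2 ≤ 1 :=
      pow_le_one₀ (scalarNorm_nonneg _) (scalarNorm_selection_le hf)
    exact mul_le_of_le_one_left (nonneg _ _) h1
  refine { nonneg := nonneg, add_le := ?_, smul := ?_, eq_zero := eq_zero, diag := ?_,
           sandwich_le := sand }
  · intro n x y
    refine le_of_forall_pos_le_add fun ε hε => ?_
    have hx := nonneg n x
    have hy := nonneg n y
    refine (le_of_fac n _ ((N n x + ε / 2) + (N n y + ε / 2)) (by positivity)
      (add n x y _ _ (by positivity) (by positivity) (fac_of_lt _ _ _ (by linarith))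
        (fac_of_lt _ _ _ (by linarith)))).trans ?_
    linarith
  · intro n z x
    refine le_antisymm (smul_le n z x) ?_
    rcases eq_or_ne z 0 with rfl | hz
    · simpa using nonneg n _
    · have h := smul_le n z⁻¹ (z • x)
      rw [smul_smul, inv_mul_cancel₀ hz, one_smul, norm_inv] at h
      have hz' : 0 < ‖z‖ := norm_pos_iff.2 hz
      rwa [inv_mul_eq_div, le_div_iff₀ hz', mul_comm] at h
  · intro m n x y
    refine le_antisymm ?_ (max_le ?_ ?_)
    · refine le_of_forall_gt_imp_ge_of_dense fun c hc => ?_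
      have hx := (le_max_left _ _).trans_lt hc
      have hy := (le_max_right _ _).trans_lt hc
      exact le_of_fac _ _ _ ((nonneg m x).trans hx.le)
        (diag m n x y c (fac_of_lt _ _ _ hx) (fac_of_lt _ _ _ hy))
    · conv_lhs => rw [← diagBlock_submatrix_castAdd x y]
      exact sub _ _ _ _ (Fin.castAdd_injective m n)
    · conv_lhs => rw [← diagBlock_submatrix_natAdd x y]
      exact sub _ _ _ _ (Fin.natAdd_injective n m)

end Gauge

/-! ### The Haagerup norm as an operator space structure. -/

section Haagerup

variable {H : Type*} [NormedAddCommGroup H] [InnerProductSpace ℂ H]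
variable {X Y : Submodule ℂ (H →L[ℂ] H)}
variable {m n : Type} [Fintype m] [Fintype n]

/-- `u = x ⊙ y` with `‖x‖² ≤ c` and `‖y‖² ≤ c`. -/
def HaagerupFac (u : Matrix n n (X ⊗[ℂ] Y)) (c : ℝ) : Prop :=
  ∃ (ι : Type) (_ : Fintype ι) (x : Matrix n ι X) (y : Matrix ι n Y),
    u = dot x y ∧ OpBdd (opMatrix x) c ∧ OpBdd (opMatrix y) c

theorem exists_eq_odot (n : ℕ) (u : Matrix (Fin n) (Fin n) (X ⊗[ℂ] Y)) :
    ∃ (r : ℕ) (x : Matrix (Fin n) (Fin r) X) (y : Matrix (Fin r) (Fin n) Y), u = odot x y := by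
  obtain ⟨ι, _, x, y, rfl⟩ := exists_eq_dot u
  let e := (Fintype.equivFin ι).symm
  exact ⟨_, x.submatrix id e, y.submatrix e id, (dot_submatrix x y e id id).symm⟩

theorem hNorm_nonneg (n : ℕ) (u : Matrix (Fin n) (Fin n) (X ⊗[ℂ] Y)) : 0 ≤ hNorm X Y n u := by
  refine Real.sInf_nonneg ?_
  rintro _ ⟨r, x, y, -, rfl⟩
  exact mul_nonneg (opNorm_nonneg _) (opNorm_nonneg _)

theorem hNorm_le {n : ℕ} {ι : Type} [Fintype ι] {x : Matrix (Fin n) ι X} {y : Matrix ι (Fin n) Y}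
    {a b : ℝ} (hx : OpBdd (opMatrix x) a) (hy : OpBdd (opMatrix y) b) (ha : 0 ≤ a) (hb : 0 ≤ b) :
    hNorm X Y n (dot x y) ≤ √a * √b := by
  let e := (Fintype.equivFin ι).symm
  have hbdd : BddBelow {t : ℝ | ∃ (r : ℕ) (x' : Matrix (Fin n) (Fin r) X)
      (y' : Matrix (Fin r) (Fin n) Y),
      dot x y = odot x' y' ∧ t = opNorm (toOp x') * opNorm (toOp y')} := by
    refine ⟨0, ?_⟩
    rintro _ ⟨r, x, y, -, rfl⟩
    exact mul_nonneg (opNorm_nonneg _) (opNorm_nonneg _)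
  refine csInf_le_of_le hbdd ⟨_, x.submatrix id e, y.submatrix e id,
    (dot_submatrix x y e id id).symm, rfl⟩ ?_
  exact mul_le_mul ((hx.submatrix (Equiv.refl _) e).opNorm_le ha)
    ((hy.submatrix e (Equiv.refl _)).opNorm_le hb) (opNorm_nonneg _) (Real.sqrt_nonneg _)

theorem HaagerupFac.hNorm_le {n : ℕ} {u : Matrix (Fin n) (Fin n) (X ⊗[ℂ] Y)} {c : ℝ}
    (h : HaagerupFac u c) (hc : 0 ≤ c) : hNorm X Y n u ≤ c := by
  obtain ⟨ι, _, x, y, rfl, hx, hy⟩ := h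
  simpa [Real.mul_self_sqrt hc] using NumRadiusOp.hNorm_le hx hy hc hc

/-- Replacing `(x, y)` by `(t x, t⁻¹ y)` leaves `x ⊙ y` unchanged, so a bound on the product of the
norms can be balanced into equal bounds on the two factors. -/
theorem HaagerupFac.of_hNorm_lt {n : ℕ} {u : Matrix (Fin n) (Fin n) (X ⊗[ℂ] Y)} {c : ℝ}
    (h : hNorm X Y n u < c) : HaagerupFac u c := by
  have hc : 0 < c := (hNorm_nonneg n u).trans_lt h
  -- Some factorization must exist, because the real infimum of the empty set is `0`.
  obtain ⟨r₀, x₀, y₀, h₀⟩ := exists_eq_odot n u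
  obtain ⟨_, ⟨r, x, y, hu, rfl⟩, hlt⟩ := exists_lt_of_csInf_lt (by exact ⟨_, r₀, x₀, y₀, h₀, rfl⟩) h
  obtain ⟨t, ht, h1, h2⟩ : ∃ t : ℝ, 0 < t ∧ t ^ 2 * opNorm (toOp x) ^ 2 ≤ c ∧
      t⁻¹ ^ 2 * opNorm (toOp y) ^ 2 ≤ c := by
    have ha := opNorm_nonneg (toOp x)
    have hb := opNorm_nonneg (toOp y)
    set a := opNorm (toOp x)
    set b := opNorm (toOp y)
    have hs : √c ^ 2 = c := Real.sq_sqrt hc.le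
    have hs0 : 0 < √c := Real.sqrt_pos.2 hc
    rcases ha.eq_or_lt with h0 | h0
    -- If `x` has norm `0`, only `y` needs shrinking; `b + 1` keeps the scale positive when `b = 0`
    -- as well.
    · refine ⟨(b + 1) / √c, by positivity, by rw [← h0]; simpa using hc.le, ?_⟩
      rw [inv_div, div_pow, hs, div_mul_eq_mul_div, div_le_iff₀ (by positivity)]
      nlinarith
    · refine ⟨√c / a, by positivity, ?_, ?_⟩
      · rw [div_pow, hs, div_mul_cancel₀ _ (by positivity)]
      · rw [inv_div, div_pow, hs, div_mul_eq_mul_div, div_le_iff₀ hc, ← mul_pow, ← pow_two]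
        exact pow_le_pow_left₀ (by positivity) hlt.le 2
  refine ⟨Fin r, inferInstance, (t : ℂ) • x, ((t⁻¹ : ℝ) : ℂ) • y, ?_, ?_, ?_⟩
  · rw [dot_smul_smul, ← Complex.ofReal_mul, mul_inv_cancel₀ ht.ne', Complex.ofReal_one, one_smul]
    exact hu
  · refine OpBdd.mono (OpBdd.smul (opBdd_opNorm (toOp x)) _) ?_
    simpa using h1
  · refine OpBdd.mono (OpBdd.smul (opBdd_opNorm (toOp y)) _) ?_
    simpa using h2

theorem HaagerupFac.submatrix {u : Matrix n n (X ⊗[ℂ] Y)} {c : ℝ} (h : HaagerupFac u c)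
    (e : m ≃ n) : HaagerupFac (u.submatrix e e) c := by
  obtain ⟨ι, _, x, y, rfl, hx, hy⟩ := h
  exact ⟨ι, inferInstance, x.submatrix e id, y.submatrix id e,
    (dot_submatrix x y (Equiv.refl _) e e).symm, hx.submatrix e (Equiv.refl _),
    hy.submatrix (Equiv.refl _) e⟩

/-- Every complex number is a product of two numbers of the same modulus. -/
theorem exists_mul_eq_norm_sq_eq (z : ℂ) : ∃ a b : ℂ, a * b = z ∧ ‖a‖ ^ 2 = ‖z‖ ∧ ‖b‖ ^ 2 = ‖z‖ := by
  rcases eq_or_ne z 0 with rfl | hz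
  · exact ⟨0, 0, by simp⟩
  · have h0 : 0 < ‖z‖ := norm_pos_iff.2 hz
    have h1 : ‖((√‖z‖ : ℝ) : ℂ)‖ ^ 2 = ‖z‖ := by
      rw [Complex.norm_real, Real.norm_of_nonneg (Real.sqrt_nonneg _), Real.sq_sqrt h0.le]
    have h2 : ((√‖z‖ : ℝ) : ℂ) ≠ 0 := by
      rw [Ne, Complex.ofReal_eq_zero]
      exact (Real.sqrt_pos.2 h0).ne'
    refine ⟨(√‖z‖ : ℝ), z / (√‖z‖ : ℝ), mul_div_cancel₀ _ h2, h1, ?_⟩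
    rw [norm_div, div_pow, h1, pow_two, mul_div_assoc, div_self h0.ne', mul_one]

theorem HaagerupFac.smul {u : Matrix n n (X ⊗[ℂ] Y)} {c : ℝ} (h : HaagerupFac u c) (z : ℂ) :
    HaagerupFac (z • u) (‖z‖ * c) := by
  obtain ⟨ι, _, x, y, rfl, hx, hy⟩ := h
  obtain ⟨a, b, hab, ha, hb⟩ := exists_mul_eq_norm_sq_eq z
  refine ⟨ι, inferInstance, a • x, b • y, by rw [dot_smul_smul, hab], ?_, ?_⟩
  · rw [← ha]; exact hx.smul a
  · rw [← hb]; exact hy.smul b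

theorem HaagerupFac.diagBlock {m n : ℕ} {u : Matrix (Fin m) (Fin m) (X ⊗[ℂ] Y)}
    {v : Matrix (Fin n) (Fin n) (X ⊗[ℂ] Y)} {c : ℝ} (hu : HaagerupFac u c)
    (hv : HaagerupFac v c) : HaagerupFac (diagBlock u v) c := by
  obtain ⟨ι, _, x, y, rfl, hx, hy⟩ := hu
  obtain ⟨κ, _, x', y', rfl, hx', hy'⟩ := hv
  refine HaagerupFac.submatrix (u := Matrix.fromBlocks (dot x y) 0 0 (dot x' y')) ?_
    finSumFinEquiv.symm
  refine ⟨ι ⊕ κ, inferInstance, _, _, (dot_fromBlocks_diag x x' y y').symm, ?_, ?_⟩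
  · rw [opMatrix_fromBlocks_diag]; exact hx.fromBlocks_diag hx'
  · rw [opMatrix_fromBlocks_diag]; exact hy.fromBlocks_diag hy'

theorem HaagerupFac.hNorm_sandwich_le {m n : ℕ} {u : Matrix (Fin m) (Fin m) (X ⊗[ℂ] Y)} {c : ℝ}
    (hu : HaagerupFac u c) (hc : 0 ≤ c) (α : Matrix (Fin n) (Fin m) ℂ)
    (β : Matrix (Fin m) (Fin n) ℂ) :
    hNorm X Y n (sandwich α u β) ≤ scalarNorm α * c * scalarNorm β := by
  obtain ⟨ι, _, x, y, rfl, hx, hy⟩ := hu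
  have e : sandwich α (dot x y) β = dot (scalarMul α x) (mulScalar y β) :=
    (dot_scalarMul_mulScalar α x y β).symm
  rw [e]
  have hα := scalarNorm_nonneg α
  have hβ := scalarNorm_nonneg β
  refine (NumRadiusOp.hNorm_le (hx.scalarMul (scalarBdd_scalarNorm α) (by positivity))
    (hy.mulScalar hc (scalarBdd_scalarNorm β)) (by positivity) (by positivity)).trans_eq ?_
  rw [Real.sqrt_mul (by positivity), Real.sqrt_mul (by positivity), Real.sqrt_sq hα,
    Real.sqrt_sq hβ]
  linear_combination scalarNorm α * scalarNorm β * Real.mul_self_sqrt hc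

theorem hNorm_sandwich_le {m n : ℕ} (α : Matrix (Fin n) (Fin m) ℂ)
    (u : Matrix (Fin m) (Fin m) (X ⊗[ℂ] Y)) (β : Matrix (Fin m) (Fin n) ℂ) :
    hNorm X Y n (sandwich α u β) ≤ scalarNorm α * hNorm X Y m u * scalarNorm β := by
  rw [mul_right_comm]
  refine le_const_mul_of_forall_lt (mul_nonneg (scalarNorm_nonneg α) (scalarNorm_nonneg β))
    fun c hc => ?_
  rw [mul_right_comm]
  exact (HaagerupFac.of_hNorm_lt hc).hNorm_sandwich_le ((hNorm_nonneg m u).trans hc.le) α β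

theorem hNorm_le_cornerBlock {n : ℕ} (u : Matrix (Fin n) (Fin n) (X ⊗[ℂ] Y)) :
    hNorm X Y n u ≤ hNorm X Y (n + n) (cornerBlock u) := by
  conv_lhs => rw [← cornerBlock_submatrix u, ← sandwich_selection]
  refine (hNorm_sandwich_le _ _ _).trans ?_
  rw [scalarNorm_conjTranspose]
  have h1 := scalarNorm_selection_le (Fin.castAdd_injective n n)
  have h2 := scalarNorm_selection_le (Fin.natAdd_injective n n)
  refine (mul_le_of_le_one_right (mul_nonneg (scalarNorm_nonneg _) (hNorm_nonneg _ _)) h2).trans ?_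
  exact mul_le_of_le_one_left (hNorm_nonneg _ _) h1

/-- The functional `x ⊗ y ↦ ⟨η, x ξ⟩ ⟨η', y ξ'⟩`. -/
def vectorFunctional (X Y : Submodule ℂ (H →L[ℂ] H)) (η ξ η' ξ' : H) : X ⊗[ℂ] Y →ₗ[ℂ] ℂ :=
  LinearMap.mul' ℂ ℂ ∘ₗ TensorProduct.map
    ((innerSL ℂ η).toLinearMap ∘ₗ (ContinuousLinearMap.apply ℂ H ξ).toLinearMap ∘ₗ X.subtype)
    ((innerSL ℂ η').toLinearMap ∘ₗ (ContinuousLinearMap.apply ℂ H ξ').toLinearMap ∘ₗ Y.subtype)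

theorem vectorFunctional_tmul (η ξ η' ξ' : H) (x : X) (y : Y) :
    vectorFunctional X Y η ξ η' ξ' (x ⊗ₜ y) =
      inner ℂ η ((x : H →L[ℂ] H) ξ) * inner ℂ η' ((y : H →L[ℂ] H) ξ') := rfl

/-- Expand `t = ∑ cₖ ⊗ Bₖ` over a basis of `Y`. Slicing the left leg by `⟨η, · ξ⟩` gives a vanishing
combination of the `Bₖ`, so every matrix coefficient of every `cₖ` vanishes. -/
theorem eq_zero_of_vectorFunctional (t : X ⊗[ℂ] Y)
    (h : ∀ η ξ η' ξ', vectorFunctional X Y η ξ η' ξ' t = 0) : t = 0 := by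
  obtain ⟨c, rfl⟩ := TensorProduct.eq_repr_basis_right (Module.Basis.ofVectorSpace ℂ Y) t
  set B := Module.Basis.ofVectorSpace ℂ Y
  have hc : c = 0 := by
    ext1 k
    refine Subtype.ext (ContinuousLinearMap.ext fun ξ => ?_)
    refine ext_inner_left ℂ fun η => ?_
    have h1 : c.sum (fun k x => (inner ℂ η ((x : H →L[ℂ] H) ξ)) • B k) = 0 := by
      refine Subtype.ext (ContinuousLinearMap.ext fun ξ' => ?_)
      refine ext_inner_left ℂ fun η' => ?_
      have h2 := h η ξ η' ξ'
      rw [Finsupp.sum, map_sum] at h2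
      simp only [vectorFunctional_tmul] at h2
      simpa [Finsupp.sum, inner_sum, inner_smul_right, sum_apply] using h2
    have h3 := linearIndependent_iff.1 B.linearIndependent
      (c.mapRange (fun x : X => inner ℂ η ((x : H →L[ℂ] H) ξ)) (by simp)) (by
        rw [Finsupp.linearCombination_apply, Finsupp.sum_mapRange_index (by simp)]
        exact h1)
    simpa using DFunLike.congr_fun h3 k
  rw [hc, Finsupp.sum_zero_index]

theorem norm_vectorFunctional_dot_le {ι : Type} [Fintype ι] {x : Matrix m ι X} {y : Matrix ι n Y}
    {a b : ℝ} (hx : OpBdd (opMatrix x) a) (hy : OpBdd (opMatrix y) b) (ha : 0 ≤ a)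
    (η ξ η' ξ' : H) (i : m) (j : n) :
    ‖vectorFunctional X Y η ξ η' ξ' (dot x y i j)‖ ^ 2 ≤
      a * b * (‖η‖ ^ 2 * ‖ξ‖ ^ 2 * (‖η'‖ ^ 2 * ‖ξ'‖ ^ 2)) := by
  classical
  -- Once the `Y` entries are evaluated, the functional becomes row `i` of `x` applied to the tuple
  -- `(cₖ ξ)`, while column `j` of `y` controls `∑ ‖cₖ‖²`.
  set c : ι → ℂ := fun k => inner ℂ η' ((y k j : H →L[ℂ] H) ξ') with hc
  have e : vectorFunctional X Y η ξ η' ξ' (dot x y i j) =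
      inner ℂ η (∑ k, opMatrix x i k (c k • ξ)) := by
    simp only [dot, Matrix.of_apply, map_sum, vectorFunctional_tmul, inner_sum, map_smul,
      inner_smul_right]
    exact Finset.sum_congr rfl fun k _ => mul_comm _ _
  have h1 : ∑ k, ‖c k‖ ^ 2 ≤ ‖η'‖ ^ 2 * (b * ‖ξ'‖ ^ 2) := by
    calc ∑ k, ‖c k‖ ^ 2 ≤ ∑ k, ‖η'‖ ^ 2 * ‖(y k j : H →L[ℂ] H) ξ'‖ ^ 2 := by
          refine Finset.sum_le_sum fun k _ => ?_
          rw [← mul_pow]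
          exact pow_le_pow_left₀ (norm_nonneg _) (norm_inner_le_norm _ _) 2
      _ ≤ _ := by
          rw [← Finset.mul_sum]
          refine mul_le_mul_of_nonneg_left ?_ (by positivity)
          have h2 := hy (Pi.single j ξ')
          have e1 : ∀ k, ∑ l, opMatrix y k l ((Pi.single j ξ' : n → H) l) =
              (y k j : H →L[ℂ] H) ξ' := by
            intro k
            rw [Finset.sum_eq_single j]
            · simp [opMatrix]
            · intro l _ hl; simp [hl]
            · simp
          have e2 : ∑ l, ‖(Pi.single j ξ' : n → H) l‖ ^ 2 = ‖ξ'‖ ^ 2 := by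
            rw [Finset.sum_eq_single j]
            · simp
            · intro l _ hl; simp [hl]
            · simp
          simpa only [e1, e2] using h2
  have h3 : ‖∑ k, opMatrix x i k (c k • ξ)‖ ^ 2 ≤ a * ∑ k, ‖c k • ξ‖ ^ 2 :=
    (Finset.single_le_sum (f := fun i => ‖∑ k, opMatrix x i k (c k • ξ)‖ ^ 2)
      (fun _ _ => by positivity) (Finset.mem_univ i)).trans (hx _)
  calc _ ≤ (‖η‖ * ‖∑ k, opMatrix x i k (c k • ξ)‖) ^ 2 := by
        rw [e]
        exact pow_le_pow_left₀ (norm_nonneg _) (norm_inner_le_norm _ _) 2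
    _ = ‖η‖ ^ 2 * ‖∑ k, opMatrix x i k (c k • ξ)‖ ^ 2 := mul_pow _ _ _
    _ ≤ ‖η‖ ^ 2 * (a * ((∑ k, ‖c k‖ ^ 2) * ‖ξ‖ ^ 2)) := by
        rw [Finset.sum_mul]
        simp only [← mul_pow, ← norm_smul]
        simp only [mul_pow]
        gcongr
    _ ≤ ‖η‖ ^ 2 * (a * ((‖η'‖ ^ 2 * (b * ‖ξ'‖ ^ 2)) * ‖ξ‖ ^ 2)) := by gcongr
    _ = _ := by ring

theorem eq_zero_of_hNorm_eq_zero {n : ℕ} {u : Matrix (Fin n) (Fin n) (X ⊗[ℂ] Y)}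
    (h : hNorm X Y n u = 0) : u = 0 := by
  ext1 i j
  refine eq_zero_of_vectorFunctional _ fun η ξ η' ξ' => ?_
  set K := ‖η‖ ^ 2 * ‖ξ‖ ^ 2 * (‖η'‖ ^ 2 * ‖ξ'‖ ^ 2)
  -- The factor `0` is the value of `hNorm X Y n u`.
  have key : ‖vectorFunctional X Y η ξ η' ξ' (u i j)‖ ≤ √K * 0 := by
    refine le_const_mul_of_forall_lt (Real.sqrt_nonneg _) fun c hc => ?_
    obtain ⟨ι, _, x, y, rfl, hx, hy⟩ := HaagerupFac.of_hNorm_lt (h.trans_lt hc)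
    refine le_of_sq_le_sq ?_ (by positivity)
    refine (norm_vectorFunctional_dot_le hx hy hc.le η ξ η' ξ' i j).trans_eq ?_
    rw [mul_pow, Real.sq_sqrt (by positivity)]
    ring
  simpa using key

theorem isNumericalRadiusSpace_hNorm [CompleteSpace H] : IsNumericalRadiusSpace (hNorm X Y) := by
  refine isNumericalRadiusSpace_of_factorization (fun n u c => HaagerupFac u c)
    hNorm_nonneg (fun n x c hc h => h.hNorm_le hc) (fun n x c h => .of_hNorm_lt h) ?_
    (fun n z x c h => h.smul z) (fun m n x y c hx hy => hx.diagBlock hy) ?_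
    fun n x h => eq_zero_of_hNorm_eq_zero h
  · rintro n _ _ c d hc hd ⟨ι, _, x, y, rfl, hx, hy⟩ ⟨κ, _, x', y', rfl, hx', hy'⟩
    refine ⟨ι ⊕ κ, inferInstance, _, _, (dot_fromCols_fromRows x x' y y').symm, ?_, ?_⟩
    · rw [opMatrix_fromCols]; exact hx.fromCols hx' hc hd
    · rw [opMatrix_fromRows]; exact hy.fromRows hy'
  · rintro m n α _ c hc ⟨ι, _, x, y, rfl, hx, hy⟩
    refine ⟨ι, inferInstance, _, _, (dot_scalarMul_mulScalar α x y αᴴ).symm,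
      hx.scalarMul (scalarBdd_scalarNorm α) (by positivity), ?_⟩
    rw [← scalarNorm_conjTranspose]
    exact hy.mulScalar hc (scalarBdd_scalarNorm αᴴ)

theorem isOperatorSpace_hNorm [CompleteSpace H] : IsOperatorSpace (hNorm X Y) :=
  { toIsMatrixNorm := isNumericalRadiusSpace_hNorm.toIsMatrixNorm
    diag := isNumericalRadiusSpace_hNorm.diag
    sandwich_le := fun _ _ α u β => hNorm_sandwich_le α u β }

end Haagerup

/-! ### The numerical radius Haagerup norms -/

section NumericalRadiusHaagerup

variable {H : Type*} [NormedAddCommGroup H] [InnerProductSpace ℂ H] [CompleteSpace H]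
variable {X Y : Submodule ℂ (H →L[ℂ] H)}
variable {m n p q ι κ : Type} [Fintype m] [Fintype n] [Fintype p] [Fintype q] [Fintype ι]
  [Fintype κ]

/-- `adj` for arbitrary index types. -/
def adjMatrix {m n : Type*} (x : Matrix m n X) : Matrix n m (dagger X) :=
  Matrix.of fun i j => ⟨star (x j i : H →L[ℂ] H), x j i, (x j i).2, rfl⟩

theorem opMatrix_adjMatrix {m n : Type*} (x : Matrix m n X) :
    opMatrix (adjMatrix x) = (opMatrix x)ᴴ := rfl

theorem exists_eq_adjMatrix {m n : Type*} (y : Matrix m n (dagger X)) :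
    ∃ x : Matrix n m X, y = adjMatrix x := by
  choose x hx hxy using fun i j => (y i j).2
  exact ⟨Matrix.of fun j i => ⟨x i j, hx i j⟩, by ext1 i j; exact Subtype.ext (hxy i j)⟩

theorem adjMatrix_smul {m n : Type*} (z : ℂ) (x : Matrix m n X) :
    adjMatrix (z • x) = star z • adjMatrix x := by
  ext1 i j
  exact Subtype.ext (star_smul z (x j i : H →L[ℂ] H))

omit [Fintype n] [Fintype p] in
theorem adjMatrix_scalarMul (α : Matrix p m ℂ) (x : Matrix m n X) :
    adjMatrix (scalarMul α x) = mulScalar (adjMatrix x) αᴴ := by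
  ext1 i j
  refine Subtype.ext ?_
  simp [adjMatrix, scalarMul, mulScalar]

omit [Fintype m] [Fintype p] in
theorem adjMatrix_mulScalar (x : Matrix m n X) (b : Matrix n p ℂ) :
    adjMatrix (mulScalar x b) = scalarMul bᴴ (adjMatrix x) := by
  ext1 i j
  refine Subtype.ext ?_
  simp [adjMatrix, scalarMul, mulScalar]

theorem adjMatrix_fromCols {m n p : Type*} (x : Matrix m n X) (y : Matrix m p X) :
    adjMatrix (Matrix.fromCols x y) = Matrix.fromRows (adjMatrix x) (adjMatrix y) := by
  ext1 (i | i) j <;> rfl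

theorem adjMatrix_fromBlocks_diag {m n p q : Type*} (x : Matrix m n X) (y : Matrix p q X) :
    adjMatrix (Matrix.fromBlocks x 0 0 y) =
      Matrix.fromBlocks (adjMatrix x) 0 0 (adjMatrix y) := by
  ext1 (i | i) (j | j) <;> refine Subtype.ext ?_ <;> simp [adjMatrix]

/-- `x x* + y* y ≤ c`, as a bound for the column with entries `x*` and `y`. -/
def ColBdd (x : Matrix n ι X) (y : Matrix ι n Y) (c : ℝ) : Prop :=
  OpBdd (Matrix.fromRows (opMatrix (adjMatrix x)) (opMatrix y)) c

theorem colBdd_iff {x : Matrix n ι X} {y : Matrix ι n Y} {c : ℝ} :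
    ColBdd x y c ↔ ∀ v : n → H, ∑ k, ‖∑ i, opMatrix (adjMatrix x) k i (v i)‖ ^ 2 +
      ∑ k, ‖∑ i, opMatrix y k i (v i)‖ ^ 2 ≤ c * ∑ i, ‖v i‖ ^ 2 := by
  simp [ColBdd, OpBdd, Fintype.sum_sum_type]

theorem ColBdd.left {x : Matrix n ι X} {y : Matrix ι n Y} {c : ℝ} (h : ColBdd x y c)
    (hc : 0 ≤ c) : OpBdd (opMatrix x) c := by
  have : OpBdd (opMatrix (adjMatrix x)) c := fun v =>
    le_of_add_le_of_nonneg_left (colBdd_iff.1 h v) (by positivity)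
  simpa [opMatrix_adjMatrix] using this.conjTranspose hc

theorem ColBdd.right {x : Matrix n ι X} {y : Matrix ι n Y} {c : ℝ} (h : ColBdd x y c) :
    OpBdd (opMatrix y) c := fun v =>
  le_of_add_le_of_nonneg_right (colBdd_iff.1 h v) (by positivity)

theorem ColBdd.submatrix {x : Matrix n ι X} {y : Matrix ι n Y} {c : ℝ} (h : ColBdd x y c)
    (e : m ≃ n) (f : κ ≃ ι) : ColBdd (x.submatrix e f) (y.submatrix f e) c := by
  have := OpBdd.submatrix h (Equiv.sumCongr f f) e
  refine cast (congrArg (fun z => OpBdd z c) ?_) this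
  ext1 (i | i) j <;> rfl

/-- For the column `z` with blocks `x*` and `y`, `z* z = x x* + y* y`, so the C*-identity applies.
-/
theorem colBdd_opNorm {n r : ℕ} (x : Matrix (Fin n) (Fin r) X) (y : Matrix (Fin r) (Fin n) Y) :
    ColBdd x y (opNorm (toOp x * (toOp x)ᴴ + (toOp y)ᴴ * toOp y)) := by
  have h := opBdd_of_opNorm_conjTranspose_mul_self
    (Matrix.fromRows (opMatrix (adjMatrix x)) (opMatrix y))
  rwa [Matrix.conjTranspose_fromRows_eq_fromCols_conjTranspose, Matrix.fromCols_mul_fromRows,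
    opMatrix_adjMatrix, Matrix.conjTranspose_conjTranspose] at h

theorem ColBdd.opNorm_le {n r : ℕ} {x : Matrix (Fin n) (Fin r) X} {y : Matrix (Fin r) (Fin n) Y}
    {c : ℝ} (h : ColBdd x y c) (hc : 0 ≤ c) :
    opNorm (toOp x * (toOp x)ᴴ + (toOp y)ᴴ * toOp y) ≤ c := by
  have h := opNorm_conjTranspose_mul_self_le h hc
  rwa [Matrix.conjTranspose_fromRows_eq_fromCols_conjTranspose, Matrix.fromCols_mul_fromRows,
    opMatrix_adjMatrix, Matrix.conjTranspose_conjTranspose] at h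

/-- `u = x ⊙ y` with `½ ‖x x* + y* y‖ ≤ c`. -/
def WhFac (u : Matrix n n (X ⊗[ℂ] Y)) (c : ℝ) : Prop :=
  ∃ (ι : Type) (_ : Fintype ι) (x : Matrix n ι X) (y : Matrix ι n Y),
    u = dot x y ∧ ColBdd x y (2 * c)

theorem whNorm_nonneg (n : ℕ) (u : Matrix (Fin n) (Fin n) (X ⊗[ℂ] Y)) : 0 ≤ whNorm X Y n u := by
  refine Real.sInf_nonneg ?_
  rintro _ ⟨r, x, y, -, rfl⟩
  exact mul_nonneg (by norm_num) (opNorm_nonneg _)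

theorem WhFac.whNorm_le {n : ℕ} {u : Matrix (Fin n) (Fin n) (X ⊗[ℂ] Y)} {c : ℝ}
    (h : WhFac u c) (hc : 0 ≤ c) : whNorm X Y n u ≤ c := by
  obtain ⟨ι, _, x, y, rfl, hxy⟩ := h
  let e := (Fintype.equivFin ι).symm
  have hbdd : BddBelow {t : ℝ | ∃ (r : ℕ) (x' : Matrix (Fin n) (Fin r) X)
      (y' : Matrix (Fin r) (Fin n) Y), dot x y = odot x' y' ∧
      t = 1 / 2 * opNorm (toOp x' * (toOp x')ᴴ + (toOp y')ᴴ * toOp y')} := by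
    refine ⟨0, ?_⟩
    rintro _ ⟨r, x, y, -, rfl⟩
    exact mul_nonneg (by norm_num) (opNorm_nonneg _)
  refine csInf_le_of_le hbdd ⟨_, x.submatrix id e, y.submatrix e id,
    (dot_submatrix x y e id id).symm, rfl⟩ ?_
  have := (hxy.submatrix (Equiv.refl _) e).opNorm_le (by positivity)
  change opNorm (toOp (x.submatrix id e) * (toOp (x.submatrix id e))ᴴ +
    (toOp (y.submatrix e id))ᴴ * toOp (y.submatrix e id)) ≤ _ at this
  linarith

theorem WhFac.of_whNorm_lt {n : ℕ} {u : Matrix (Fin n) (Fin n) (X ⊗[ℂ] Y)} {c : ℝ}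
    (h : whNorm X Y n u < c) : WhFac u c := by
  obtain ⟨r₀, x₀, y₀, h₀⟩ := exists_eq_odot n u
  obtain ⟨_, ⟨r, x, y, hu, rfl⟩, hlt⟩ :=
    exists_lt_of_csInf_lt (by exact ⟨_, r₀, x₀, y₀, h₀, rfl⟩) h
  exact ⟨Fin r, inferInstance, x, y, hu, OpBdd.mono (colBdd_opNorm x y) (by linarith)⟩

theorem WhFac.submatrix {u : Matrix n n (X ⊗[ℂ] Y)} {c : ℝ} (h : WhFac u c) (e : m ≃ n) :
    WhFac (u.submatrix e e) c := by
  obtain ⟨ι, _, x, y, rfl, hxy⟩ := h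
  exact ⟨ι, inferInstance, x.submatrix e id, y.submatrix id e,
    (dot_submatrix x y (Equiv.refl _) e e).symm, hxy.submatrix e (Equiv.refl _)⟩

theorem WhFac.add {u v : Matrix n n (X ⊗[ℂ] Y)} {c d : ℝ} (hu : WhFac u c) (hv : WhFac v d) :
    WhFac (u + v) (c + d) := by
  obtain ⟨ι, _, x, y, rfl, h⟩ := hu
  obtain ⟨κ, _, x', y', rfl, h'⟩ := hv
  refine ⟨ι ⊕ κ, inferInstance, _, _, (dot_fromCols_fromRows x x' y y').symm,
    colBdd_iff.2 fun w => ?_⟩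
  have h1 := colBdd_iff.1 h w
  have h2 := colBdd_iff.1 h' w
  rw [adjMatrix_fromCols, opMatrix_fromRows, opMatrix_fromRows]
  simp only [Fintype.sum_sum_type, Matrix.fromRows_apply_inl, Matrix.fromRows_apply_inr]
  linarith

theorem WhFac.smul {u : Matrix n n (X ⊗[ℂ] Y)} {c : ℝ} (h : WhFac u c) (z : ℂ) :
    WhFac (z • u) (‖z‖ * c) := by
  obtain ⟨ι, _, x, y, rfl, h⟩ := h
  -- The balanced splitting scales both halves of the column by the same factor `‖z‖`.
  obtain ⟨a, b, hab, ha, hb⟩ := exists_mul_eq_norm_sq_eq z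
  refine ⟨ι, inferInstance, a • x, b • y, by rw [dot_smul_smul, hab], colBdd_iff.2 fun w => ?_⟩
  have h1 := mul_le_mul_of_nonneg_left (colBdd_iff.1 h w) (norm_nonneg z)
  have e1 : ∀ k, ∑ i, opMatrix (adjMatrix (a • x)) k i (w i) =
      star a • ∑ i, opMatrix (adjMatrix x) k i (w i) := by
    intro k
    rw [adjMatrix_smul, Finset.smul_sum]
    rfl
  have e2 : ∀ k, ∑ i, opMatrix (b • y) k i (w i) = b • ∑ i, opMatrix y k i (w i) := by
    intro k
    rw [Finset.smul_sum]
    rfl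
  simp only [e1, e2, norm_smul, mul_pow, norm_star, ha, hb, ← Finset.mul_sum]
  linarith

theorem WhFac.diagBlock {m n : ℕ} {u : Matrix (Fin m) (Fin m) (X ⊗[ℂ] Y)}
    {v : Matrix (Fin n) (Fin n) (X ⊗[ℂ] Y)} {c : ℝ} (hu : WhFac u c) (hv : WhFac v c) :
    WhFac (diagBlock u v) c := by
  obtain ⟨ι, _, x, y, rfl, h⟩ := hu
  obtain ⟨κ, _, x', y', rfl, h'⟩ := hv
  refine WhFac.submatrix (u := Matrix.fromBlocks (dot x y) 0 0 (dot x' y')) ?_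
    finSumFinEquiv.symm
  refine ⟨ι ⊕ κ, inferInstance, _, _, (dot_fromBlocks_diag x x' y y').symm,
    colBdd_iff.2 fun w => ?_⟩
  have h1 := colBdd_iff.1 h fun i => w (Sum.inl i)
  have h2 := colBdd_iff.1 h' fun i => w (Sum.inr i)
  rw [adjMatrix_fromBlocks_diag, opMatrix_fromBlocks_diag, opMatrix_fromBlocks_diag]
  simp only [Fintype.sum_sum_type, Matrix.fromBlocks_apply₁₁, Matrix.fromBlocks_apply₁₂,
    Matrix.fromBlocks_apply₂₁, Matrix.fromBlocks_apply₂₂, Matrix.zero_apply, zero_apply,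
    Finset.sum_const_zero, add_zero, zero_add]
  linarith

theorem WhFac.sandwich {m n : ℕ} {u : Matrix (Fin m) (Fin m) (X ⊗[ℂ] Y)} {c : ℝ}
    (hu : WhFac u c) (hc : 0 ≤ c) (α : Matrix (Fin n) (Fin m) ℂ) :
    WhFac (sandwich α u αᴴ) (scalarNorm α ^ 2 * c) := by
  obtain ⟨ι, _, x, y, rfl, h⟩ := hu
  refine ⟨ι, inferInstance, _, _, (dot_scalarMul_mulScalar α x y αᴴ).symm,
    colBdd_iff.2 fun w => ?_⟩
  simp only [adjMatrix_scalarMul, sum_opMatrix_mulScalar]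
  refine (colBdd_iff.1 h _).trans ?_
  have h1 := (scalarBdd_scalarNorm αᴴ).sum_norm_sq_le w
  rw [scalarNorm_conjTranspose] at h1
  have h2 := mul_le_mul_of_nonneg_left h1 (show 0 ≤ 2 * c by positivity)
  linarith

theorem HaagerupFac.whFac {u : Matrix n n (X ⊗[ℂ] Y)} {c : ℝ} (h : HaagerupFac u c)
    (hc : 0 ≤ c) : WhFac u c := by
  obtain ⟨ι, _, x, y, rfl, hx, hy⟩ := h
  refine ⟨ι, inferInstance, x, y, rfl, ?_⟩
  rw [two_mul]
  exact (hx.conjTranspose hc).fromRows hy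

theorem WhFac.haagerupFac {u : Matrix n n (X ⊗[ℂ] Y)} {c : ℝ} (h : WhFac u c)
    (hc : 0 ≤ c) : HaagerupFac u (2 * c) := by
  obtain ⟨ι, _, x, y, rfl, hxy⟩ := h
  exact ⟨ι, inferInstance, x, y, rfl, hxy.left (by positivity), hxy.right⟩

/-- The corner is `(x; 0) ⊙ (0, y)`, for which `x x* + y* y` becomes block diagonal: its bound is
the maximum `c`, not `2c`. -/
theorem HaagerupFac.whFac_cornerBlock {n : ℕ} {u : Matrix (Fin n) (Fin n) (X ⊗[ℂ] Y)} {c : ℝ}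
    (h : HaagerupFac u c) (hc : 0 ≤ c) : WhFac (cornerBlock u) (1 / 2 * c) := by
  obtain ⟨ι, _, x, y, rfl, hx, hy⟩ := h
  refine WhFac.submatrix (u := Matrix.fromBlocks 0 (dot x y) 0 0) ?_ finSumFinEquiv.symm
  refine ⟨ι, inferInstance, Matrix.fromRows x 0, Matrix.fromCols 0 y, ?_,
    colBdd_iff.2 fun w => ?_⟩
  · ext (i | i) (j | j) <;> simp [dot]
  · have h1 := hx.conjTranspose hc fun i => w (Sum.inl i)
    have h2 := hy fun i => w (Sum.inr i)
    have e1 : ∀ k, ∑ i, opMatrix (adjMatrix (Matrix.fromRows x (0 : Matrix (Fin n) ι X))) k i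
        (w i) = ∑ i, (opMatrix x)ᴴ k i (w (Sum.inl i)) := by
      intro k
      simp [Fintype.sum_sum_type, opMatrix, adjMatrix]
    have e2 : ∀ k, ∑ i, opMatrix (Matrix.fromCols (0 : Matrix ι (Fin n) Y) y) k i (w i) =
        ∑ i, opMatrix y k i (w (Sum.inr i)) := by
      intro k
      simp [Fintype.sum_sum_type, opMatrix]
    simp only [e1, e2]
    rw [Fintype.sum_sum_type]
    linarith

theorem hNorm_le_two_mul_whNorm (n : ℕ) (u : Matrix (Fin n) (Fin n) (X ⊗[ℂ] Y)) :
    hNorm X Y n u ≤ 2 * whNorm X Y n u := by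
  refine le_const_mul_of_forall_lt (by norm_num) fun c hc => ?_
  have hc0 : 0 ≤ c := (whNorm_nonneg n u).trans hc.le
  exact ((WhFac.of_whNorm_lt hc).haagerupFac hc0).hNorm_le (by positivity)

theorem whNorm_le_hNorm (n : ℕ) (u : Matrix (Fin n) (Fin n) (X ⊗[ℂ] Y)) :
    whNorm X Y n u ≤ hNorm X Y n u := by
  refine le_of_forall_gt_imp_ge_of_dense fun c hc => ?_
  have hc0 : 0 ≤ c := (hNorm_nonneg n u).trans hc.le
  exact ((HaagerupFac.of_hNorm_lt hc).whFac hc0).whNorm_le hc0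

theorem isNumericalRadiusSpace_whNorm : IsNumericalRadiusSpace (whNorm X Y) := by
  refine isNumericalRadiusSpace_of_factorization (fun n u c => WhFac u c)
    whNorm_nonneg (fun n x c hc h => h.whNorm_le hc) (fun n x c h => .of_whNorm_lt h)
    (fun n x y c d _ _ hx hy => hx.add hy) (fun n z x c h => h.smul z)
    (fun m n x y c hx hy => hx.diagBlock hy) (fun m n α x c hc h => h.sandwich hc α) ?_
  intro n x h
  have h1 := hNorm_le_two_mul_whNorm n x
  rw [h, mul_zero] at h1
  exact eq_zero_of_hNorm_eq_zero (le_antisymm h1 (hNorm_nonneg n x))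

theorem isAffiliated_whNorm : IsAffiliated (whNorm X Y) (hNorm X Y) where
  operatorSpace := isOperatorSpace_hNorm
  numericalRadiusSpace := isNumericalRadiusSpace_whNorm
  ow n u := by
    refine le_antisymm ?_ ?_
    · have h1 := hNorm_le_cornerBlock u
      have h2 := hNorm_le_two_mul_whNorm _ (cornerBlock u)
      linarith
    · refine le_const_mul_of_forall_lt (by norm_num) fun c hc => ?_
      have hc0 : 0 ≤ c := (hNorm_nonneg n u).trans hc.le
      exact ((HaagerupFac.of_hNorm_lt hc).whFac_cornerBlock hc0).whNorm_le (by positivity)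

/-! ### The norm `wcbNorm` and its comparison with `whNorm` on `X ⊗ X†`. -/

/-- `u = x a ⊙ x*` with `‖a‖ ≤ 1` and `½ ‖x‖² ≤ c`. -/
def WcbFac (u : Matrix n n (X ⊗[ℂ] dagger X)) (c : ℝ) : Prop :=
  ∃ (ι : Type) (_ : Fintype ι) (x : Matrix n ι X) (a : Matrix ι ι ℂ),
    u = dot (mulScalar x a) (adjMatrix x) ∧ ScalarBdd a 1 ∧ OpBdd (opMatrix x) (2 * c)

omit [Fintype m] [Fintype n] in
theorem dot_mulScalar_adjMatrix_submatrix (x : Matrix n ι X) (a : Matrix ι ι ℂ) (f : m → n)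
    (e : κ ≃ ι) :
    dot (mulScalar (x.submatrix f e) (a.submatrix e e)) (adjMatrix (x.submatrix f e)) =
      (dot (mulScalar x a) (adjMatrix x)).submatrix f f := by
  rw [← dot_submatrix _ _ e f f]
  congr 1
  ext1 i j
  exact e.sum_comp fun k => a k (e j) • x (f i) k

omit [Fintype n] in
/-- Every `x ⊙ y*` is of the form `z a ⊙ z*` with the nilpotent block matrix `a`. -/
theorem dot_mulScalar_nilpotent [DecidableEq ι] (x y : Matrix n ι X) :
    dot (mulScalar (Matrix.fromCols x y) (Matrix.fromBlocks 0 1 0 0))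
      (adjMatrix (Matrix.fromCols x y)) = dot x (adjMatrix y) := by
  have e : mulScalar (Matrix.fromCols x y) (Matrix.fromBlocks 0 1 0 0) =
      Matrix.fromCols (0 : Matrix n ι X) x := by
    ext1 i (j | j) <;> simp [mulScalar, Fintype.sum_sum_type, Matrix.one_apply]
  rw [e, adjMatrix_fromCols, dot_fromCols_fromRows]
  ext i j
  simp [dot]

/-- Both bounds on `a` are kept because they serve different ends: the norm bound gives `wcbNorm ≤
whNorm`, the numerical radius bound one inequality of the formula for `whNorm`. -/
theorem WhFac.exists_nilpotent {u : Matrix n n (X ⊗[ℂ] dagger X)} {c : ℝ} (h : WhFac u c)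
    (hc : 0 ≤ c) : ∃ (ι : Type) (_ : Fintype ι) (x : Matrix n ι X) (a : Matrix ι ι ℂ),
      u = dot (mulScalar x a) (adjMatrix x) ∧ ScalarBdd a 1 ∧ NumRadLE a (1 / 2) ∧
        OpBdd (opMatrix x) (2 * c) := by
  classical
  obtain ⟨ι, _, x, y, rfl, h⟩ := h
  obtain ⟨y, rfl⟩ := exists_eq_adjMatrix y
  refine ⟨ι ⊕ ι, inferInstance, _, _, (dot_mulScalar_nilpotent x y).symm, scalarBdd_nilpotent,
    numRadLE_nilpotent, ?_⟩
  have h1 := OpBdd.conjTranspose h (by positivity)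
  rwa [← opMatrix_fromRows, ← adjMatrix_fromCols, opMatrix_adjMatrix,
    Matrix.conjTranspose_conjTranspose] at h1

theorem WhFac.wcbFac {u : Matrix n n (X ⊗[ℂ] dagger X)} {c : ℝ} (h : WhFac u c) (hc : 0 ≤ c) :
    WcbFac u c := by
  obtain ⟨ι, hι, x, a, hu, ha, -, hx⟩ := h.exists_nilpotent hc
  exact ⟨ι, hι, x, a, hu, ha, hx⟩

theorem WcbFac.haagerupFac {u : Matrix n n (X ⊗[ℂ] dagger X)} {c : ℝ} (h : WcbFac u c)
    (hc : 0 ≤ c) : HaagerupFac u (2 * c) := by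
  obtain ⟨ι, _, x, a, rfl, ha, hx⟩ := h
  refine ⟨ι, inferInstance, _, _, rfl, ?_, hx.conjTranspose (by positivity)⟩
  simpa using hx.mulScalar (by positivity) ha

theorem wcbNorm_nonneg (n : ℕ) (u : Matrix (Fin n) (Fin n) (X ⊗[ℂ] dagger X)) :
    0 ≤ wcbNorm X n u := by
  refine Real.sInf_nonneg ?_
  rintro _ ⟨r, x, a, -, rfl⟩
  have := scalarNorm_nonneg a
  positivity

theorem WcbFac.wcbNorm_le {n : ℕ} {u : Matrix (Fin n) (Fin n) (X ⊗[ℂ] dagger X)} {c : ℝ}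
    (h : WcbFac u c) (hc : 0 ≤ c) : wcbNorm X n u ≤ c := by
  obtain ⟨ι, _, x, a, rfl, ha, hx⟩ := h
  let e := (Fintype.equivFin ι).symm
  have hbdd : BddBelow {t : ℝ | ∃ (r : ℕ) (x' : Matrix (Fin n) (Fin r) X)
      (a' : Matrix (Fin r) (Fin r) ℂ),
      dot (mulScalar x a) (adjMatrix x) = odot (rightMul x' a') (adj x') ∧
      t = 1 / 2 * scalarNorm a' * opNorm (toOp x') ^ 2} := by
    refine ⟨0, ?_⟩
    rintro _ ⟨r, x, a, -, rfl⟩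
    have := scalarNorm_nonneg a
    positivity
  refine csInf_le_of_le hbdd ⟨_, x.submatrix id e, a.submatrix e e,
    (dot_mulScalar_adjMatrix_submatrix x a id e).symm, rfl⟩ ?_
  have h1 : opNorm (toOp (x.submatrix id e)) ^ 2 ≤ 2 * c :=
    (hx.submatrix (Equiv.refl _) e).opNorm_sq_le (by positivity)
  have h2 : scalarNorm (a.submatrix e e) ≤ 1 :=
    ScalarBdd.scalarNorm_le (by simpa using ha.submatrix e e) zero_le_one
  have h3 := mul_le_mul h2 h1 (by positivity) zero_le_one
  linarith

theorem exists_eq_odot_adj (n : ℕ) (u : Matrix (Fin n) (Fin n) (X ⊗[ℂ] dagger X)) :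
    ∃ (r : ℕ) (x : Matrix (Fin n) (Fin r) X) (a : Matrix (Fin r) (Fin r) ℂ),
      u = odot (rightMul x a) (adj x) := by
  classical
  obtain ⟨ι, _, x, y, rfl⟩ := exists_eq_dot u
  obtain ⟨y, rfl⟩ := exists_eq_adjMatrix y
  rw [← dot_mulScalar_nilpotent]
  let e := (Fintype.equivFin (ι ⊕ ι)).symm
  exact ⟨_, (Matrix.fromCols x y).submatrix id e, Matrix.submatrix _ e e,
    (dot_mulScalar_adjMatrix_submatrix _ _ id e).symm⟩

omit [Fintype n] in
theorem dot_mulScalar_smul (z : ℂ) (t : ℝ) (x : Matrix n ι X) (a : Matrix ι ι ℂ) :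
    dot (mulScalar ((t : ℂ) • x) (z • a)) (adjMatrix ((t : ℂ) • x)) =
      ((t : ℂ) ^ 2 * z) • dot (mulScalar x a) (adjMatrix x) := by
  have e : mulScalar ((t : ℂ) • x) (z • a) = ((t : ℂ) * z) • mulScalar x a := by
    ext1 i j
    simp only [mulScalar, Matrix.of_apply, Matrix.smul_apply, Finset.smul_sum, smul_smul,
      smul_eq_mul]
    refine Finset.sum_congr rfl fun k _ => ?_
    congr 1
    ring
  have e2 : star (t : ℂ) = t := Complex.conj_ofReal t
  rw [e, adjMatrix_smul, dot_smul_smul, e2]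
  congr 1
  ring

theorem ScalarBdd.smul {a : Matrix m n ℂ} {c : ℝ} (h : ScalarBdd a c) (z : ℂ) :
    ScalarBdd (z • a) (‖z‖ ^ 2 * c) := by
  intro ξ
  rw [Matrix.smul_mulVec]
  simp only [Pi.smul_apply, norm_smul, mul_pow, ← Finset.mul_sum, mul_assoc]
  gcongr
  exact h ξ

theorem WcbFac.of_wcbNorm_lt {n : ℕ} {u : Matrix (Fin n) (Fin n) (X ⊗[ℂ] dagger X)} {c : ℝ}
    (h : wcbNorm X n u < c) : WcbFac u c := by
  obtain ⟨r₀, x₀, a₀, h₀⟩ := exists_eq_odot_adj n u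
  obtain ⟨_, ⟨r, x, a, hu, rfl⟩, hlt⟩ :=
    exists_lt_of_csInf_lt (by exact ⟨_, r₀, x₀, a₀, h₀, rfl⟩) h
  -- A `t` strictly above `‖a‖` is nonzero even when `a = 0`, so `a / t` is a contraction and `√t`
  -- can go into `x`.
  obtain ⟨t, ht, h1⟩ : ∃ t, scalarNorm a < t ∧ t * opNorm (toOp x) ^ 2 ≤ 2 * c := by
    set N := opNorm (toOp x) ^ 2 with hN
    have hN0 : 0 ≤ N := by positivity
    set δ := 2 * c - scalarNorm a * N with hδ
    have hδ0 : 0 < δ := by rw [hδ]; linarith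
    refine ⟨scalarNorm a + δ / (N + 1), by linarith [show 0 < δ / (N + 1) by positivity], ?_⟩
    have : δ / (N + 1) * N ≤ δ := by
      rw [div_mul_eq_mul_div, div_le_iff₀ (by positivity)]
      nlinarith
    rw [add_mul]
    linarith
  have ht0 : 0 < t := (scalarNorm_nonneg a).trans_lt ht
  have hs : √t ^ 2 = t := Real.sq_sqrt ht0.le
  refine ⟨Fin r, inferInstance, ((√t : ℝ) : ℂ) • x, ((t⁻¹ : ℝ) : ℂ) • a, ?_, ?_, ?_⟩
  · rw [dot_mulScalar_smul, ← Complex.ofReal_pow, hs, ← Complex.ofReal_mul,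
      mul_inv_cancel₀ ht0.ne', Complex.ofReal_one, one_smul]
    exact hu
  · intro ξ
    refine ((scalarBdd_scalarNorm a).smul _ ξ).trans ?_
    have h2 : ‖((t⁻¹ : ℝ) : ℂ)‖ ^ 2 * scalarNorm a ^ 2 ≤ 1 := by
      rw [Complex.norm_real, Real.norm_of_nonneg (by positivity), ← mul_pow, inv_mul_eq_div]
      exact pow_le_one₀ (div_nonneg (scalarNorm_nonneg a) ht0.le) ((div_le_one ht0).2 ht.le)
    gcongr
  · refine OpBdd.mono (OpBdd.smul (opBdd_opNorm (toOp x)) _) ?_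
    rw [Complex.norm_real, Real.norm_of_nonneg (by positivity), hs]
    exact h1

theorem WcbFac.submatrix {u : Matrix n n (X ⊗[ℂ] dagger X)} {c : ℝ} (h : WcbFac u c)
    (e : m ≃ n) : WcbFac (u.submatrix e e) c := by
  obtain ⟨ι, _, x, a, rfl, ha, hx⟩ := h
  exact ⟨ι, inferInstance, x.submatrix e id, a,
    (dot_mulScalar_adjMatrix_submatrix x a e (Equiv.refl _)).symm, ha,
    hx.submatrix e (Equiv.refl _)⟩

theorem WcbFac.add {u v : Matrix n n (X ⊗[ℂ] dagger X)} {c d : ℝ} (hu : WcbFac u c)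
    (hv : WcbFac v d) (hc : 0 ≤ c) (hd : 0 ≤ d) : WcbFac (u + v) (c + d) := by
  obtain ⟨ι, _, x, a, rfl, ha, hx⟩ := hu
  obtain ⟨κ, _, x', a', rfl, ha', hx'⟩ := hv
  refine ⟨ι ⊕ κ, inferInstance, Matrix.fromCols x x', Matrix.fromBlocks a 0 0 a', ?_,
    ha.fromBlocks_diag ha', ?_⟩
  · have e : mulScalar (Matrix.fromCols x x') (Matrix.fromBlocks a 0 0 a') =
        Matrix.fromCols (mulScalar x a) (mulScalar x' a') := by
      ext1 i (j | j) <;> simp [mulScalar, Fintype.sum_sum_type]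
    rw [e, adjMatrix_fromCols, dot_fromCols_fromRows]
  · rw [opMatrix_fromCols, mul_add]
    exact hx.fromCols hx' (by positivity) (by positivity)

theorem WcbFac.smul {u : Matrix n n (X ⊗[ℂ] dagger X)} {c : ℝ} (h : WcbFac u c) (z : ℂ) :
    WcbFac (z • u) (‖z‖ * c) := by
  obtain ⟨ι, _, x, a, rfl, ha, hx⟩ := h
  have hs : √‖z‖ ^ 2 = ‖z‖ := Real.sq_sqrt (norm_nonneg z)
  -- The modulus goes into the two copies of `x` and the phase into `a`; at `z = 0` the quotient is
  -- `0` by convention.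
  refine ⟨ι, inferInstance, ((√‖z‖ : ℝ) : ℂ) • x, (z / ‖z‖) • a, ?_, ?_, ?_⟩
  · rw [dot_mulScalar_smul, ← Complex.ofReal_pow, hs]
    rcases eq_or_ne z 0 with rfl | hz
    · simp
    · rw [mul_div_cancel₀ _ (by simpa using hz)]
  · intro ξ
    refine (ha.smul _ ξ).trans ?_
    have h2 : ‖z / ‖z‖‖ ^ 2 * 1 ≤ 1 := by
      rw [mul_one, norm_div, Complex.norm_real, norm_norm]
      exact pow_le_one₀ (by positivity) (div_self_le_one _)
    gcongr
  · refine (hx.smul _).mono ?_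
    rw [Complex.norm_real, Real.norm_of_nonneg (by positivity), hs]
    linarith

theorem WcbFac.diagBlock {m n : ℕ} {u : Matrix (Fin m) (Fin m) (X ⊗[ℂ] dagger X)}
    {v : Matrix (Fin n) (Fin n) (X ⊗[ℂ] dagger X)} {c : ℝ} (hu : WcbFac u c)
    (hv : WcbFac v c) : WcbFac (diagBlock u v) c := by
  obtain ⟨ι, _, x, a, rfl, ha, hx⟩ := hu
  obtain ⟨κ, _, x', a', rfl, ha', hx'⟩ := hv
  refine WcbFac.submatrix (u := Matrix.fromBlocks (dot (mulScalar x a) (adjMatrix x)) 0 0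
    (dot (mulScalar x' a') (adjMatrix x'))) ?_ finSumFinEquiv.symm
  refine ⟨ι ⊕ κ, inferInstance, Matrix.fromBlocks x 0 0 x', Matrix.fromBlocks a 0 0 a', ?_,
    ha.fromBlocks_diag ha', ?_⟩
  · have e : mulScalar (Matrix.fromBlocks x 0 0 x') (Matrix.fromBlocks a 0 0 a') =
        Matrix.fromBlocks (mulScalar x a) 0 0 (mulScalar x' a') := by
      ext1 (i | i) (j | j) <;> simp [mulScalar, Fintype.sum_sum_type]
    rw [e, adjMatrix_fromBlocks_diag, dot_fromBlocks_diag]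
  · rw [opMatrix_fromBlocks_diag]
    exact hx.fromBlocks_diag hx'

theorem WcbFac.sandwich {m n : ℕ} {u : Matrix (Fin m) (Fin m) (X ⊗[ℂ] dagger X)} {c : ℝ}
    (hu : WcbFac u c) (α : Matrix (Fin n) (Fin m) ℂ) :
    WcbFac (sandwich α u αᴴ) (scalarNorm α ^ 2 * c) := by
  obtain ⟨ι, _, x, a, rfl, ha, hx⟩ := hu
  refine ⟨ι, inferInstance, scalarMul α x, a, ?_, ha, ?_⟩
  · rw [scalarMul_mulScalar, adjMatrix_scalarMul, dot_scalarMul_mulScalar]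
    rfl
  · rw [mul_left_comm]
    exact hx.scalarMul (scalarBdd_scalarNorm α) (by positivity)

/-- The nilpotent trick with `diag(x, y)` in place of `[x y]`: the squared norm of a block diagonal
is bounded by `c` instead of `2c`. -/
theorem HaagerupFac.wcbFac_cornerBlock {n : ℕ} {u : Matrix (Fin n) (Fin n) (X ⊗[ℂ] dagger X)}
    {c : ℝ} (h : HaagerupFac u c) (hc : 0 ≤ c) : WcbFac (cornerBlock u) (1 / 2 * c) := by
  classical
  obtain ⟨ι, _, x, y, rfl, hx, hy⟩ := h
  obtain ⟨y, rfl⟩ := exists_eq_adjMatrix y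
  refine WcbFac.submatrix (u := Matrix.fromBlocks 0 (dot x (adjMatrix y)) 0 0) ?_
    finSumFinEquiv.symm
  refine ⟨ι ⊕ ι, inferInstance, Matrix.fromBlocks x 0 0 y, Matrix.fromBlocks 0 1 0 0, ?_,
    scalarBdd_nilpotent, ?_⟩
  · have e : mulScalar (Matrix.fromBlocks x 0 0 y) (Matrix.fromBlocks 0 1 0 0) =
        Matrix.fromBlocks (0 : Matrix (Fin n) ι X) x 0 0 := by
      ext1 (i | i) (j | j) <;> simp [mulScalar, Fintype.sum_sum_type, Matrix.one_apply]
    rw [e, adjMatrix_fromBlocks_diag]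
    ext (i | i) (j | j) <;> simp [dot, Fintype.sum_sum_type]
  · rw [opMatrix_fromBlocks_diag, show 2 * (1 / 2 * c) = c by ring]
    have := hy.conjTranspose hc
    rw [opMatrix_adjMatrix, Matrix.conjTranspose_conjTranspose] at this
    exact hx.fromBlocks_diag this

theorem hNorm_le_two_mul_wcbNorm (n : ℕ) (u : Matrix (Fin n) (Fin n) (X ⊗[ℂ] dagger X)) :
    hNorm X (dagger X) n u ≤ 2 * wcbNorm X n u := by
  refine le_const_mul_of_forall_lt (by norm_num) fun c hc => ?_
  have hc0 : 0 ≤ c := (wcbNorm_nonneg n u).trans hc.le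
  exact ((WcbFac.of_wcbNorm_lt hc).haagerupFac hc0).hNorm_le (by positivity)

theorem wcbNorm_le_whNorm (n : ℕ) (u : Matrix (Fin n) (Fin n) (X ⊗[ℂ] dagger X)) :
    wcbNorm X n u ≤ whNorm X (dagger X) n u := by
  refine le_of_forall_gt_imp_ge_of_dense fun c hc => ?_
  have hc0 : 0 ≤ c := (whNorm_nonneg n u).trans hc.le
  exact ((WhFac.of_whNorm_lt hc).wcbFac hc0).wcbNorm_le hc0

theorem isNumericalRadiusSpace_wcbNorm : IsNumericalRadiusSpace (wcbNorm X) := by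
  refine isNumericalRadiusSpace_of_factorization (fun n u c => WcbFac u c)
    wcbNorm_nonneg (fun n x c hc h => h.wcbNorm_le hc) (fun n x c h => .of_wcbNorm_lt h)
    (fun n x y c d hc hd hx hy => hx.add hy hc hd) (fun n z x c h => h.smul z)
    (fun m n x y c hx hy => hx.diagBlock hy) (fun m n α x c _ h => h.sandwich α) ?_
  intro n x h
  have h1 := hNorm_le_two_mul_wcbNorm n x
  rw [h, mul_zero] at h1
  exact eq_zero_of_hNorm_eq_zero (le_antisymm h1 (hNorm_nonneg n x))

theorem isAffiliated_wcbNorm : IsAffiliated (wcbNorm X) (hNorm X (dagger X)) where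
  operatorSpace := isOperatorSpace_hNorm
  numericalRadiusSpace := isNumericalRadiusSpace_wcbNorm
  ow n u := by
    refine le_antisymm ?_ ?_
    · have h1 := hNorm_le_cornerBlock u
      have h2 := hNorm_le_two_mul_wcbNorm _ (cornerBlock u)
      linarith
    · refine le_const_mul_of_forall_lt (by norm_num) fun c hc => ?_
      have hc0 : 0 ≤ c := (hNorm_nonneg n u).trans hc.le
      exact ((HaagerupFac.of_hNorm_lt hc).wcbFac_cornerBlock hc0).wcbNorm_le (by positivity)

/-! ### The formula for `whNorm` in terms of the numerical radius. -/

/-- A factorization `x a ⊙ x*` with `a` of numerical radius less than `t` yields a factorization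
for the numerical radius Haagerup norm. -/
theorem NumRadLE.whFac {x : Matrix n ι X} {a : Matrix ι ι ℂ} {w s t d : ℝ} (ha : NumRadLE a w)
    (hws : w < s) (hs : 0 < s) (hst : s < t) (hx : OpBdd (opMatrix x) d) (hd : 0 ≤ d) :
    WhFac (dot (mulScalar x a) (adjMatrix x)) (d * t) := by
  classical
  obtain ⟨κ, _, b, c, rfl, hbc⟩ := ha.exists_factor hws hs hst
  refine ⟨κ, inferInstance, mulScalar x b, scalarMul c (adjMatrix x), ?_, ?_⟩
  · rw [mulScalar_mul, dot_mulScalar]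
  -- The column with blocks `(x b)*` and `c x*` is `(b*; c) x*`, and the square of the scalar column
  -- is `b b* + c* c ≤ 2t`.
  · have e : Matrix.fromRows (opMatrix (adjMatrix (mulScalar x b)))
        (opMatrix (scalarMul c (adjMatrix x))) =
        opMatrix (scalarMul (Matrix.fromRows bᴴ c) (adjMatrix x)) := by
      rw [adjMatrix_mulScalar]
      ext1 (i | i) j <;> rfl
    have hβ : ScalarBdd (Matrix.fromRows bᴴ c) (2 * t) := by
      intro ξ
      -- For `H = ℂ` the statement about tuples of vectors is the plain scalar bound.
      refine sum_norm_sq_le_of_posSemidef (H := ℂ) ?_ ξ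
      rwa [Matrix.conjTranspose_fromRows_eq_fromCols_conjTranspose,
        Matrix.fromCols_mul_fromRows, Matrix.conjTranspose_conjTranspose]
    rw [ColBdd, e, show 2 * (d * t) = 2 * t * d by ring]
    have hx' : OpBdd (opMatrix (adjMatrix x)) d := by
      rw [opMatrix_adjMatrix]
      exact hx.conjTranspose hd
    exact hx'.scalarMul hβ (by linarith)

theorem whNorm_eq_sInf_numericalRadius (n : ℕ)
    (u : Matrix (Fin n) (Fin n) (X ⊗[ℂ] dagger X)) :
    whNorm X (dagger X) n u =
      sInf {t : ℝ | ∃ (r : ℕ) (x : Matrix (Fin n) (Fin r) X) (a : Matrix (Fin r) (Fin r) ℂ),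
        u = odot (rightMul x a) (adj x) ∧ t = numericalRadius a * opNorm (toOp x) ^ 2} := by
  refine le_antisymm (le_csInf ?_ ?_) (le_of_forall_gt_imp_ge_of_dense fun c hc => ?_)
  · obtain ⟨r, x, a, h⟩ := exists_eq_odot_adj n u
    exact ⟨_, r, x, a, h, rfl⟩
  · rintro _ ⟨r, x, a, rfl, rfl⟩
    rw [mul_comm]
    refine le_const_mul_of_forall_lt (by positivity) fun t ht => ?_
    obtain ⟨s, hs, hst⟩ := exists_between ht
    have hs0 : 0 < s := (numericalRadius_nonneg a).trans_lt hs
    exact ((numRadLE_numericalRadius a).whFac hs hs0 hst (opBdd_opNorm (toOp x))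
      (by positivity)).whNorm_le (mul_nonneg (by positivity) (hs0.trans hst).le)
  · have hc0 : 0 ≤ c := (whNorm_nonneg n u).trans hc.le
    obtain ⟨ι, _, x, a, rfl, -, ha, hx⟩ := (WhFac.of_whNorm_lt hc).exists_nilpotent hc0
    let e := (Fintype.equivFin ι).symm
    have h1 : opNorm (toOp (x.submatrix id e)) ^ 2 ≤ 2 * c :=
      (hx.submatrix (Equiv.refl _) e).opNorm_sq_le (by positivity)
    have h2 : numericalRadius (a.submatrix e e) ≤ 1 / 2 :=
      (ha.submatrix e).numericalRadius_le (by norm_num)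
    refine csInf_le_of_le ⟨0, ?_⟩ ⟨_, x.submatrix id e, a.submatrix e e,
      (dot_mulScalar_adjMatrix_submatrix x a id e).symm, rfl⟩ ?_
    · rintro _ ⟨r, x, a, -, rfl⟩
      exact mul_nonneg (numericalRadius_nonneg a) (by positivity)
    · have := mul_le_mul h2 h1 (by positivity) (by norm_num)
      linarith

end NumericalRadiusHaagerup

end

end NumRadiusOp

theorem mainTheorem10 {H : Type*} [NormedAddCommGroup H] [InnerProductSpace ℂ H]
    [CompleteSpace H] (X Y : Submodule ℂ (H →L[ℂ] H)) :
    -- every matrix over `X ⊗ Y` has the form `x ⊙ y`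
    (∀ (n : ℕ) (u : Matrix (Fin n) (Fin n) (X ⊗[ℂ] Y)),
      ∃ (r : ℕ) (x : Matrix (Fin n) (Fin r) X) (y : Matrix (Fin r) (Fin n) Y), u = odot x y) ∧
    -- (a)
    IsAffiliated (whNorm X Y) (hNorm X Y) ∧
    -- (b)
    IsAffiliated (whNorm X (dagger X)) (hNorm X (dagger X)) ∧
    IsAffiliated (wcbNorm X) (hNorm X (dagger X)) ∧
    (∀ (n : ℕ) (u : Matrix (Fin n) (Fin n) (X ⊗[ℂ] dagger X)),
      whNorm X (dagger X) n u =
        sInf {t : ℝ | ∃ (r : ℕ) (x : Matrix (Fin n) (Fin r) X) (a : Matrix (Fin r) (Fin r) ℂ),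
          u = odot (rightMul x a) (adj x) ∧ t = numericalRadius a * opNorm (toOp x) ^ 2}) ∧
    (∀ (n : ℕ) (u : Matrix (Fin n) (Fin n) (X ⊗[ℂ] dagger X)),
      1 / 2 * hNorm X (dagger X) n u ≤ wcbNorm X n u ∧
      wcbNorm X n u ≤ whNorm X (dagger X) n u ∧
      whNorm X (dagger X) n u ≤ hNorm X (dagger X) n u) := by
  refine ⟨exists_eq_odot, isAffiliated_whNorm, isAffiliated_whNorm, isAffiliated_wcbNorm,
    whNorm_eq_sInf_numericalRadius, fun n u => ⟨?_, wcbNorm_le_whNorm n u, whNorm_le_hNorm n u⟩⟩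
  linarith [hNorm_le_two_mul_wcbNorm n u]
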